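/- Let $N\ge 1$, $l_1,\dots,l_N>0$, $T>0$, $D_1,\dots,D_N>0$, and put $\underline D=\min_i D_i$, $\overline D=\max_i D_i$, $Q_i=(0,l_i)\times(0,T)$. The intervals $(0,l_i)$ are the edges of a star graph, with $x=0$ as the common vertex. Let $$\mathbb L^2=\prod_{i=1}^N L^2(0,l_i),\quad \|v\|_{\mathbb L^2}^2=\sum_i\|v_i\|_{L^2(0,l_i)}^2,\qquad \mathbb L^\infty=\prod_{i=1}^N L^\infty(Q_i),\quad \|u\|_{\mathbb L^\infty}=\sum_i\|u_i\|_{L^\infty(Q_i)},$$ $$\mathbb V=\Big\{\varphi\in\prod_{i=1}^N H^1(0,l_i):\ \varphi_i(0)=\varphi_j(0),\ \varphi_i(l_i)=0\ \text{ for all } i,j\Big\},\qquad \|\varphi\|_{\mathbb V}^2=\sum_i\|\varphi_i\|_{H^1(0,l_i)}^2 ,$$ and let $\mathbb V^\star$ be the topological dual of $\mathbb V$. With $\mathbb V\hookrightarrow\mathbb L^2\hookrightarrow\mathbb V^\star$ (where $\rho\in\mathbb L^2$ acts on $\mathbb V$ by the scalar product $(\rho,\cdot)$ of $\mathbb L^2$),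 let $$\mathbb W(0,T)=\{\rho\in L^2(0,T;\mathbb V):\ \rho_t\in L^2(0,T;\mathbb V^\star)\},\qquad \|\rho\|_{\mathbb W(0,T)}^2=\|\rho\|_{L^2(0,T;\mathbb V)}^2+\|\rho_t\|_{L^2(0,T;\mathbb V^\star)}^2 .$$ Let $f\in L^2(0,T;\mathbb V^\star)$, $u\in\mathbb L^\infty$ and $\rho^0\in\mathbb L^2$. Consider the system ($i,j=1,\dots,N$) $$\begin{cases}\partial_t\rho_i-D_i\,\partial_x^2\rho_i-\partial_x(u_i\rho_i)=f_i & \text{in } Q_i,\\ \rho_i(x,0)=\rho_i^0(x), & x\in(0,l_i),\\ \sum_{i=1}^N\big[D_i\,\partial_x\rho_i(0,t)+u_i(0,t)\rho_i(0,t)\big]=0, & t\in(0,T),\\ \rho_i(0,t)=\rho_j(0,t),\quad \rho_i(l_i,t)=0, & t\in(0,T).\end{cases}$$ A weak solution is a $\rho\in\mathbb W(0,T)$ such that, for every $\varphi\in\mathbb V$, $$\frac{d}{dt}(\rho(\cdot),\varphi)+\sum_{i=1}^N\int_0^{l_i}\big(D_i\,\partial_x\rho_i+u_i\rho_i\big)\,\partial_x\varphi_i\,dx=\langle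 f(\cdot),\varphi\rangle_{\mathbb V^\star,\mathbb V}\quad\text{in }\mathcal D'(0,T),$$ and $\rho$ has a representative in $C([0,T];\mathbb L^2)$ whose value at $t=0$ is $\rho^0$. **Theorem.** The system has a unique weak solution $\rho\in\mathbb W(0,T)$. Moreover, there is a constant $C>0$ depending only on $T$, $\underline D$, $\overline D$ and $\|u\|_{\mathbb L^\infty}$, continuously on the latter, such that $$\|\rho\|_{C([0,T];\mathbb L^2)}+\|\rho\|_{L^2(0,T;\mathbb V)}\le C\big(\|\rho^0\|_{\mathbb L^2}+\|f\|_{L^2(0,T;\mathbb V^\star)}\big),\qquad \|\rho\|_{\mathbb W(0,T)}\le C\big(\|\rho^0\|_{\mathbb L^2}+\|f\|_{L^2(0,T;\mathbb V^\star)}\big).$$ -/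

import Mathlib

open MeasureTheory Set
open scoped ENNReal Distributions

noncomputable section

namespace StarGraph

/-- The open interval `(a,b)`, as a bundled open subset of `ℝ`. -/
def interval (a b : ℝ) : TopologicalSpace.Opens ℝ := ⟨Ioo a b, isOpen_Ioo⟩

/-- Lebesgue measure on the open interval `(a,b)`. -/
abbrev leb (a b : ℝ) : Measure ℝ := volume.restrict (Ioo a b)

/-- `L²(0,T;E)` (Bochner space of classes of functions, with its usual norm). -/
abbrev L2Time (T : ℝ) (E : Type*) [NormedAddCommGroup E] := Lp E 2 (leb 0 T)

/-- `𝕃² = ∏ᵢ L²(0,lᵢ)`, with norm `(∑ᵢ ‖vᵢ‖²)^{1/2}` and the corresponding scalar product. -/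
abbrev L2 {N : ℕ} (l : Fin N → ℝ) := PiLp 2 (fun i : Fin N => Lp ℝ 2 (leb 0 (l i)))

/-- `𝕃^∞ = ∏ᵢ L^∞(Qᵢ)`, `Qᵢ = (0,lᵢ) × (0,T)`, with norm `∑ᵢ ‖uᵢ‖_{L^∞(Qᵢ)}`. -/
abbrev LInfty {N : ℕ} (l : Fin N → ℝ) (T : ℝ) :=
  PiLp 1 (fun i : Fin N => Lp ℝ ∞ ((volume : Measure (ℝ × ℝ)).restrict (Ioo 0 (l i) ×ˢ Ioo 0 T)))

/-- `w` is the weak derivative of `v` on `(0,b)`. -/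
def IsWeakDeriv {b : ℝ} (v w : Lp ℝ 2 (leb 0 b)) : Prop :=
  ∀ ψ : 𝓓(interval 0 b, ℝ),
    ∫ x in Ioo 0 b, v x * deriv ψ x = -∫ x in Ioo 0 b, w x * ψ x

/-- `g` is the weak derivative on `(0,T)` of the Banach-space-valued function `h`. -/
def IsWeakTimeDeriv (T : ℝ) {E : Type*} [NormedAddCommGroup E] [NormedSpace ℝ E]
    (h g : ℝ → E) : Prop :=
  ∀ θ : 𝓓(interval 0 T, ℝ),
    ∫ t in Ioo 0 T, deriv θ t • h t = -∫ t in Ioo 0 T, θ t • g t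

theorem testFunction_memLp {a b : ℝ} (ψ : 𝓓(interval a b, ℝ)) (p : ℝ≥0∞) (μ : Measure ℝ)
    [IsFiniteMeasureOnCompacts μ] : MemLp ψ p μ :=
  ψ.contDiff.continuous.memLp_of_hasCompactSupport ψ.hasCompactSupport

theorem testFunction_deriv_memLp {a b : ℝ} (ψ : 𝓓(interval a b, ℝ)) (p : ℝ≥0∞) (μ : Measure ℝ)
    [IsFiniteMeasureOnCompacts μ] : MemLp (deriv ψ) p μ :=
  (ψ.contDiff.continuous_deriv (by simp)).memLp_of_hasCompactSupport ψ.hasCompactSupport.deriv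

theorem IsWeakDeriv.zero {b : ℝ} : IsWeakDeriv (0 : Lp ℝ 2 (leb 0 b)) 0 := by
  intro ψ
  have e := Lp.coeFn_zero ℝ 2 (leb 0 b)
  have e1 : ∫ x in Ioo 0 b, (0 : Lp ℝ 2 (leb 0 b)) x * deriv ψ x = 0 := by
    apply integral_eq_zero_of_ae
    filter_upwards [e] with x hx
    rw [hx, Pi.zero_apply, zero_mul]
  have e2 : ∫ x in Ioo 0 b, (0 : Lp ℝ 2 (leb 0 b)) x * ψ x = 0 := by
    apply integral_eq_zero_of_ae
    filter_upwards [e] with x hx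
    rw [hx, Pi.zero_apply, zero_mul]
  rw [e1, e2, neg_zero]

theorem IsWeakDeriv.add {b : ℝ} {v w v' w' : Lp ℝ 2 (leb 0 b)}
    (h : IsWeakDeriv v w) (h' : IsWeakDeriv v' w') : IsWeakDeriv (v + v') (w + w') := by
  intro ψ
  have i1 := (Lp.memLp v).integrable_mul (testFunction_deriv_memLp ψ 2 (leb 0 b))
  have i2 := (Lp.memLp v').integrable_mul (testFunction_deriv_memLp ψ 2 (leb 0 b))
  have i3 := (Lp.memLp w).integrable_mul (testFunction_memLp ψ 2 (leb 0 b))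
  have i4 := (Lp.memLp w').integrable_mul (testFunction_memLp ψ 2 (leb 0 b))
  have e1 : ∫ x in Ioo 0 b, (v + v') x * deriv ψ x
      = ∫ x in Ioo 0 b, (v x * deriv ψ x + v' x * deriv ψ x) := by
    apply integral_congr_ae
    filter_upwards [Lp.coeFn_add v v'] with x hx
    rw [hx, Pi.add_apply, add_mul]
  have e2 : ∫ x in Ioo 0 b, (w + w') x * ψ x
      = ∫ x in Ioo 0 b, (w x * ψ x + w' x * ψ x) := by
    apply integral_congr_ae
    filter_upwards [Lp.coeFn_add w w'] with x hx
    rw [hx, Pi.add_apply, add_mul]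
  rw [e1, e2]
  refine (integral_add i1 i2).trans ?_
  refine Eq.trans ?_ (congrArg Neg.neg (integral_add i3 i4)).symm
  rw [neg_add]
  exact congrArg₂ (· + ·) (h ψ) (h' ψ)

theorem IsWeakDeriv.smul {b : ℝ} {v w : Lp ℝ 2 (leb 0 b)} (c : ℝ)
    (h : IsWeakDeriv v w) : IsWeakDeriv (c • v) (c • w) := by
  intro ψ
  have e1 : ∫ x in Ioo 0 b, (c • v) x * deriv ψ x = ∫ x in Ioo 0 b, c * (v x * deriv ψ x) := by
    apply integral_congr_ae
    filter_upwards [Lp.coeFn_smul c v] with x hx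
    rw [hx, Pi.smul_apply, smul_eq_mul, mul_assoc]
  have e2 : ∫ x in Ioo 0 b, (c • w) x * ψ x = ∫ x in Ioo 0 b, c * (w x * ψ x) := by
    apply integral_congr_ae
    filter_upwards [Lp.coeFn_smul c w] with x hx
    rw [hx, Pi.smul_apply, smul_eq_mul, mul_assoc]
  rw [e1, e2, integral_const_mul, integral_const_mul, h ψ]
  ring

/-- `ℍ¹ = ∏ᵢ H¹(0,lᵢ)`. An element is stored as the pair `(φ, ∂ₓφ)`, where `∂ₓφᵢ ∈ L²(0,lᵢ)` is the
weak derivative of `φᵢ ∈ L²(0,lᵢ)`; the norm is `(∑ᵢ (‖φᵢ‖² + ‖∂ₓφᵢ‖²))^{1/2}`. -/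
def H1 {N : ℕ} (l : Fin N → ℝ) : Submodule ℝ (WithLp 2 (L2 l × L2 l)) where
  carrier := {φ | ∀ i, IsWeakDeriv (φ.fst i) (φ.snd i)}
  zero_mem' := fun _ => IsWeakDeriv.zero
  add_mem' := fun h h' i => (h i).add (h' i)
  smul_mem' := fun c _ h i => (h i).smul c

/-- `v` is the representative of `φ ∈ 𝕃²` that is continuous on each closed edge `[0,lᵢ]`. -/
def IsEdgeRep {N : ℕ} {l : Fin N → ℝ} (φ : L2 l) (v : Fin N → ℝ → ℝ) : Prop :=
  ∀ i, ContinuousOn (v i) (Icc 0 (l i)) ∧ φ i =ᵐ[leb 0 (l i)] v i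

/-- The subspace `𝕍` of `ℍ¹`: the elements `φ` of `ℍ¹` with `φᵢ(0) = φⱼ(0)` for all `i, j` and
`φᵢ(lᵢ) = 0` for all `i`. Boundary values are those of the continuous representatives. -/
def VSub {N : ℕ} (l : Fin N → ℝ) : Submodule ℝ (WithLp 2 (L2 l × L2 l)) where
  carrier := {φ | φ ∈ H1 l ∧ ∃ v : Fin N → ℝ → ℝ,
    IsEdgeRep φ.fst v ∧ (∀ i j, v i 0 = v j 0) ∧ ∀ i, v i (l i) = 0}
  zero_mem' := ⟨(H1 l).zero_mem, 0, fun _ => ⟨continuousOn_const, Lp.coeFn_zero ..⟩,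
    fun _ _ => rfl, fun _ => rfl⟩
  add_mem' := by
    rintro φ φ' ⟨h, v, hv, h0, hl⟩ ⟨h', v', hv', h0', hl'⟩
    refine ⟨(H1 l).add_mem h h', v + v', fun i => ⟨(hv i).1.add (hv' i).1, ?_⟩, ?_, ?_⟩
    · exact (Lp.coeFn_add (φ.fst i) (φ'.fst i)).trans ((hv i).2.add (hv' i).2)
    · intro i j
      simp only [Pi.add_apply, h0 i j, h0' i j]
    · intro i
      simp only [Pi.add_apply, hl i, hl' i, add_zero]
  smul_mem' := by
    rintro c φ ⟨h, v, hv, h0, hl⟩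
    refine ⟨(H1 l).smul_mem c h, c • v, fun i => ⟨(hv i).1.const_smul c, ?_⟩, ?_, ?_⟩
    · exact (Lp.coeFn_smul c (φ.fst i)).trans ((hv i).2.const_smul c)
    · intro i j
      simp only [Pi.smul_apply, h0 i j]
    · intro i
      simp only [Pi.smul_apply, hl i, smul_zero]

/-- The space `𝕍`, with the norm and scalar product of `ℍ¹`. -/
def V {N : ℕ} (l : Fin N → ℝ) : Type := ↥(VSub l)

instance {N : ℕ} (l : Fin N → ℝ) : NormedAddCommGroup (V l) :=
  inferInstanceAs (NormedAddCommGroup ↥(VSub l))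

instance {N : ℕ} (l : Fin N → ℝ) : InnerProductSpace ℝ (V l) :=
  inferInstanceAs (InnerProductSpace ℝ ↥(VSub l))

/-- `𝕍*`, the topological dual of `𝕍` with the dual norm. -/
abbrev VDual {N : ℕ} (l : Fin N → ℝ) := StrongDual ℝ (V l)

/-- The function part of an element of `𝕍`, i.e. the embedding `𝕍 ↪ 𝕃²`. -/
def toL2 {N : ℕ} {l : Fin N → ℝ} : V l →L[ℝ] L2 l :=
  (WithLp.fstL 2 ℝ (L2 l) (L2 l)).comp (VSub l).subtypeL

/-- The derivative part `∂ₓφ` of an element `φ` of `𝕍`. -/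
def dx {N : ℕ} {l : Fin N → ℝ} : V l →L[ℝ] L2 l :=
  (WithLp.sndL 2 ℝ (L2 l) (L2 l)).comp (VSub l).subtypeL

section Triple

variable {E H : Type*} [NormedAddCommGroup E] [NormedSpace ℝ E]
  [NormedAddCommGroup H] [InnerProductSpace ℝ H]

/-- For an embedding `j : E ↪ H`, the induced embedding `E ↪ H ≅ H* ↪ E*`, `ρ ↦ (φ ↦ (jρ, jφ)_H)`. -/
def toDual (j : E →L[ℝ] H) (ρ : E) : StrongDual ℝ E := (innerSL ℝ (j ρ)).comp j

theorem toDual_add (j : E →L[ℝ] H) (ρ ρ' : E) : toDual j (ρ + ρ') = toDual j ρ + toDual j ρ' := by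
  ext φ
  simp [toDual]

theorem toDual_smul (j : E →L[ℝ] H) (c : ℝ) (ρ : E) : toDual j (c • ρ) = c • toDual j ρ := by
  ext φ
  simp [toDual]

theorem toDual_norm_le (j : E →L[ℝ] H) (ρ : E) : ‖toDual j ρ‖ ≤ ‖j‖ * ‖j‖ * ‖ρ‖ := by
  refine (ContinuousLinearMap.opNorm_comp_le _ _).trans ?_
  rw [innerSL_apply_norm, mul_right_comm]
  exact mul_le_mul_of_nonneg_right (j.le_opNorm ρ) (norm_nonneg _)

/-- `ρ ↦ toDual j ρ` as a bounded operator. -/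
def toDualL (j : E →L[ℝ] H) : E →L[ℝ] StrongDual ℝ E :=
  LinearMap.mkContinuous
    { toFun := toDual j, map_add' := toDual_add j, map_smul' := toDual_smul j }
    (‖j‖ * ‖j‖) (toDual_norm_le j)

theorem integrable_smul_of_memLp {T : ℝ} {η : ℝ → ℝ} {h : ℝ → E}
    (hη : MemLp η 2 (leb 0 T)) (hh : MemLp h 2 (leb 0 T)) :
    Integrable (fun t => η t • h t) (leb 0 T) :=
  memLp_one_iff_integrable.1 (hh.smul hη)

/-- For an embedding `j : E ↪ H`, the space `{ρ ∈ L²(0,T;E) : ρ_t ∈ L²(0,T;E*)}`. An element is stored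
as the pair `(ρ, ρ_t)`, where `ρ_t` is the weak time derivative of `ρ`, seen as a function with
values in `E*`; the norm is `(‖ρ‖²_{L²(0,T;E)} + ‖ρ_t‖²_{L²(0,T;E*)})^{1/2}`. -/
def WSub (j : E →L[ℝ] H) (T : ℝ) :
    Submodule ℝ (WithLp 2 (L2Time T E × L2Time T (StrongDual ℝ E))) where
  carrier := {ρ | IsWeakTimeDeriv T (fun t => toDual j (ρ.fst t)) ρ.snd}
  zero_mem' := by
    intro θ
    have e1 : ∫ t in Ioo 0 T, deriv θ t • toDual j ((0 : L2Time T E) t) = 0 := by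
      apply integral_eq_zero_of_ae
      filter_upwards [Lp.coeFn_zero E 2 (leb 0 T)] with t ht
      rw [ht]
      simp [toDual]
    have e2 : ∫ t in Ioo 0 T, θ t • (0 : L2Time T (StrongDual ℝ E)) t = 0 := by
      apply integral_eq_zero_of_ae
      filter_upwards [Lp.coeFn_zero (StrongDual ℝ E) 2 (leb 0 T)] with t ht
      rw [ht]
      simp
    refine e1.trans ?_
    rw [← neg_zero]
    exact congrArg Neg.neg e2.symm
  add_mem' := by
    intro ρ ρ' h h' θ
    have m1 := (toDualL j).comp_memLp' (Lp.memLp ρ.fst)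
    have m2 := (toDualL j).comp_memLp' (Lp.memLp ρ'.fst)
    have i1 := integrable_smul_of_memLp (testFunction_deriv_memLp θ 2 (leb 0 T)) m1
    have i2 := integrable_smul_of_memLp (testFunction_deriv_memLp θ 2 (leb 0 T)) m2
    have i3 := integrable_smul_of_memLp (testFunction_memLp θ 2 (leb 0 T)) (Lp.memLp ρ.snd)
    have i4 := integrable_smul_of_memLp (testFunction_memLp θ 2 (leb 0 T)) (Lp.memLp ρ'.snd)
    have e1 : ∫ t in Ioo 0 T, deriv θ t • toDual j ((ρ + ρ').fst t)
        = ∫ t in Ioo 0 T, (deriv θ t • toDual j (ρ.fst t) + deriv θ t • toDual j (ρ'.fst t)) := by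
      apply integral_congr_ae
      filter_upwards [Lp.coeFn_add ρ.fst ρ'.fst] with t ht
      rw [WithLp.add_fst, ht, Pi.add_apply, toDual_add, smul_add]
    have e2 : ∫ t in Ioo 0 T, θ t • (ρ + ρ').snd t
        = ∫ t in Ioo 0 T, (θ t • ρ.snd t + θ t • ρ'.snd t) := by
      apply integral_congr_ae
      filter_upwards [Lp.coeFn_add ρ.snd ρ'.snd] with t ht
      rw [WithLp.add_snd, ht, Pi.add_apply, smul_add]
    rw [e1, e2]
    refine (integral_add i1 i2).trans ?_
    refine Eq.trans ?_ (congrArg Neg.neg (integral_add i3 i4)).symm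
    rw [neg_add]
    exact congrArg₂ (· + ·) (h θ) (h' θ)
  smul_mem' := by
    intro c ρ h θ
    have e1 : ∫ t in Ioo 0 T, deriv θ t • toDual j ((c • ρ).fst t)
        = ∫ t in Ioo 0 T, c • (deriv θ t • toDual j (ρ.fst t)) := by
      apply integral_congr_ae
      filter_upwards [Lp.coeFn_smul c ρ.fst] with t ht
      rw [WithLp.smul_fst, ht, Pi.smul_apply, toDual_smul, smul_comm]
    have e2 : ∫ t in Ioo 0 T, θ t • (c • ρ).snd t = ∫ t in Ioo 0 T, c • (θ t • ρ.snd t) := by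
      apply integral_congr_ae
      filter_upwards [Lp.coeFn_smul c ρ.snd] with t ht
      rw [WithLp.smul_snd, ht, Pi.smul_apply, smul_comm]
    rw [e1, e2, integral_smul, integral_smul, ← smul_neg]
    exact congrArg (c • ·) (h θ)

end Triple

/-- `𝕎(0,T) = {ρ ∈ L²(0,T;𝕍) : ρ_t ∈ L²(0,T;𝕍*)}` for the embeddings `𝕍 ↪ 𝕃² ↪ 𝕍*`, with the norm
`(‖ρ‖²_{L²(0,T;𝕍)} + ‖ρ_t‖²_{L²(0,T;𝕍*)})^{1/2}`. -/
abbrev W {N : ℕ} (l : Fin N → ℝ) (T : ℝ) :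
    Submodule ℝ (WithLp 2 (L2Time T (V l) × L2Time T (VDual l))) :=
  WSub (toL2 : V l →L[ℝ] L2 l) T

/-- The underlying element of `L²(0,T;𝕍)` of an element of `𝕎(0,T)`. -/
def toL2V {N : ℕ} {l : Fin N → ℝ} {T : ℝ} (ρ : W l T) : L2Time T (V l) :=
  (ρ : WithLp 2 (L2Time T (V l) × L2Time T (VDual l))).fst

/-- `r ∈ C([0,T];𝕃²)` is the continuous representative of `ρ`: `r(t) = ρ(t)` in `𝕃²` for almost every
`t ∈ (0,T)`. -/
def IsTimeRep {N : ℕ} {l : Fin N → ℝ} {T : ℝ} (ρ : W l T) (r : C(Icc 0 T, L2 l)) : Prop :=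
  ∀ᵐ t ∂(leb 0 T), ∀ ht : t ∈ Icc 0 T, r ⟨t, ht⟩ = toL2 (toL2V ρ t)

/-- The form `𝓕[u](φ,ψ) = ∑ᵢ ∫₀^{lᵢ} (Dᵢ ∂ₓφᵢ + uᵢ(·,t) φᵢ) ∂ₓψᵢ dx` at time `t`. -/
def form {N : ℕ} {l : Fin N → ℝ} {T : ℝ} (D : Fin N → ℝ) (u : LInfty l T) (t : ℝ)
    (φ ψ : V l) : ℝ :=
  ∑ i, ∫ x in Ioo 0 (l i), (D i * dx φ i x + u i (x, t) * toL2 φ i x) * dx ψ i x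

/-- Weak solutions `ρ ∈ 𝕎(0,T)` of the Fokker-Planck system with diffusions `D`, drift `u`, source `f`
and initial datum `ρ₀`: for every `φ ∈ 𝕍`,
`d/dt (ρ(·),φ) + 𝓕[u](ρ(·),φ) = ⟨f(·),φ⟩` in the sense of distributions on `(0,T)`, and the
continuous representative of `ρ` takes the value `ρ₀` at `t = 0`. -/
structure IsWeakSolution {N : ℕ} {l : Fin N → ℝ} {T : ℝ} (hT : 0 < T) (D : Fin N → ℝ)
    (u : LInfty l T) (f : L2Time T (VDual l)) (ρ₀ : L2 l) (ρ : W l T) : Prop where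
  equation : ∀ φ : V l, ∀ θ : 𝓓(interval 0 T, ℝ),
    -(∫ t in Ioo 0 T, inner ℝ (toL2 (toL2V ρ t)) (toL2 φ) * deriv θ t)
      + ∫ t in Ioo 0 T, form D u t (toL2V ρ t) φ * θ t
      = ∫ t in Ioo 0 T, f t φ * θ t
  initial : ∃ r : C(Icc 0 T, L2 l), IsTimeRep ρ r ∧ r ⟨0, left_mem_Icc.2 hT.le⟩ = ρ₀

end StarGraph

end

/-!
The equation is an abstract parabolic equation `ρ' + B(t)ρ = f` in `V*` for the triple `V ↪ H ↪ V*`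
with `V = 𝕍` and `H = 𝕃²`; most of the file treats this equation for an arbitrary triple given by a
bounded map `j : V → H` and a measurable, uniformly bounded family of forms `B(t)` with Gårding's
inequality `α‖v‖² ≤ B(t)(v,v) + λ‖jv‖²`.

*Time regularity.* A `ρ ∈ W(0,T)` equals, as a function with values in `V*`, a constant plus the
primitive of its derivative `g` (`IsWeakTimeDeriv.exists_ae_eq_primitive`). Hence `‖ρ(t+h)‖²_H -
‖ρ(t)‖²_H = ∫ ⟨g(t+s), ρ(t+h) + ρ(t)⟩ ds` over `0 < s < h`. Replacing `ρ(t+h) + ρ(t)` by `2ρ(t+s)`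
costs, after integration in `t`, only `o(h)`, because translations are continuous in `L²(ℝ;V)`. So
`‖ρ‖²_H - 2∫⟨g,ρ⟩` has vanishing weak derivative, which is the energy identity
`exists_energy_identity`; no regularization of `ρ` in time is needed. The energy identity in turn
gives a modulus of continuity in `H`, hence the representative in `C([0,T];H)`
(`exists_continuousMap_ae_eq`).

*Existence* is Lions' projection lemma (`exists_forall_apply_eq_of_norm_le`). The time derivative
is moved onto `C¹` test functions `ψ` with `ψ(T) = 0`, and testing the resulting form with the pair
`(e^{2λt}ψ, ψ)` gives the coercivity `coercive_exp_test`: the weight produces the term `λ‖jψ‖²`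
that Gårding's inequality needs. The initial value of the solution is read off from `T - t` as a
test function.

*Estimates and uniqueness* follow from the energy identity, Gårding's inequality and Grönwall's
inequality (`IsEvolutionSolution.norm_rep_le`); the bound for `ρ'` is read off from the equation.

*Application to the star graph.* The conditions at the vertex and at the outer ends, which are
formulated with continuous representatives, are equivalent to equations between continuous
functionals of the pair `(φ, ∂ₓφ)` in `𝕃² × 𝕃²` (`mem_VSub_iff`); so `𝕍` is closed there, hence a
separable Hilbert space. Young's inequality gives Gårding's inequality for the form `𝓕[u]` with `α
= D̲/2` and `λ = ‖u‖²/(2D̲) + D̲/2` (`exists_timeForm_eq_form`). Neither these numbers nor the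
bound `D̄ + ‖u‖` of the form involve `N` or the lengths of the edges, and so neither does the
constant in the estimates.
-/

noncomputable section

namespace StarGraph

open scoped ContDiff

/-! ### Weak derivatives and primitives on an interval -/

section WeakDerivative

theorem intervalIntegrable_of_leb {E : Type*} [NormedAddCommGroup E] {T : ℝ} {g : ℝ → E}
    (hg : Integrable g (leb 0 T)) {a b : ℝ}
    (ha : a ∈ Icc 0 T) (hb : b ∈ Icc 0 T) : IntervalIntegrable g volume a b := by
  have h : IntegrableOn g (Ioc 0 T) := (integrableOn_Ioc_iff_integrableOn_Ioo).2 hg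
  rw [intervalIntegrable_iff]
  refine h.mono_set fun x hx => ?_
  rcases le_total a b with hab | hab
  · rw [uIoc_of_le hab] at hx; exact ⟨ha.1.trans_lt hx.1, hx.2.trans hb.2⟩
  · rw [uIoc_of_ge hab] at hx; exact ⟨hb.1.trans_lt hx.1, hx.2.trans ha.2⟩

variable {E : Type*} [NormedAddCommGroup E] [NormedSpace ℝ E] {T : ℝ}

theorem integral_Ioo_eq_intervalIntegral (g : ℝ → E) (hT : 0 ≤ T) :
    ∫ t in Ioo 0 T, g t = ∫ t in (0 : ℝ)..T, g t := by
  rw [intervalIntegral.integral_of_le hT, integral_Ioc_eq_integral_Ioo]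

theorem continuousOn_primitive_leb {g : ℝ → E} (hT : 0 ≤ T) (hg : Integrable g (leb 0 T)) :
    ContinuousOn (fun t => ∫ s in (0 : ℝ)..t, g s) (Icc 0 T) := by
  have h : IntegrableOn g (Icc 0 T) := (integrableOn_Icc_iff_integrableOn_Ioo).2 hg
  have := intervalIntegral.continuousOn_primitive_interval (a := 0) (b := T) (μ := volume) (f := g)
    (by rwa [uIcc_of_le hT])
  rwa [uIcc_of_le hT] at this

/-- Fubini's theorem on the triangle `0 < s < t < T`: integration by parts for a primitive. -/
theorem integral_deriv_smul_primitive [CompleteSpace E] {θ : ℝ → ℝ} (hθ : ContDiff ℝ 1 θ)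
    {g : ℝ → E} (hg : Integrable g (leb 0 T)) :
    ∫ t in Ioo 0 T, deriv θ t • ∫ s in (0 : ℝ)..t, g s = ∫ s in Ioo 0 T, (θ T - θ s) • g s := by
  have hc : Continuous (deriv θ) := hθ.continuous_deriv le_rfl
  have hd : Integrable (deriv θ) (leb 0 T) :=
    (hc.integrableOn_Icc (a := 0) (b := T)).mono_set Ioo_subset_Icc_self
  have hS : MeasurableSet {z : ℝ × ℝ | z.2 < z.1} := measurableSet_lt measurable_snd measurable_fst
  have hI : Integrable (Function.uncurry fun t s =>
      ({z : ℝ × ℝ | z.2 < z.1}.indicator (fun z => deriv θ z.1 • g z.2)) (t, s))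
      ((leb 0 T).prod (leb 0 T)) := (hd.smul_prod hg).indicator hS
  have hswap := integral_integral_swap hI
  have e1 : ∫ t in Ioo 0 T, deriv θ t • ∫ s in (0 : ℝ)..t, g s
      = ∫ t in Ioo 0 T, ∫ s in Ioo 0 T,
        ({z : ℝ × ℝ | z.2 < z.1}.indicator (fun z => deriv θ z.1 • g z.2)) (t, s) := by
    refine setIntegral_congr_fun measurableSet_Ioo fun t ht => ?_
    have : (fun s => ({z : ℝ × ℝ | z.2 < z.1}.indicator (fun z => deriv θ z.1 • g z.2)) (t, s))
        = (Iio t).indicator fun s => deriv θ t • g s := by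
      ext s; simp [indicator_apply]
    rw [this, setIntegral_indicator measurableSet_Iio, Ioo_inter_Iio, min_eq_right ht.2.le,
      integral_smul, intervalIntegral.integral_of_le ht.1.le, integral_Ioc_eq_integral_Ioo]
  have e2 : ∫ s in Ioo 0 T, (θ T - θ s) • g s
      = ∫ s in Ioo 0 T, ∫ t in Ioo 0 T,
        ({z : ℝ × ℝ | z.2 < z.1}.indicator (fun z => deriv θ z.1 • g z.2)) (t, s) := by
    refine setIntegral_congr_fun measurableSet_Ioo fun s hs => ?_
    have : (fun t => ({z : ℝ × ℝ | z.2 < z.1}.indicator (fun z => deriv θ z.1 • g z.2)) (t, s))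
        = (Ioi s).indicator fun t => deriv θ t • g s := by
      ext t; simp [indicator_apply]
    rw [this, setIntegral_indicator measurableSet_Ioi, inter_comm, Ioi_inter_Ioo,
      max_eq_left hs.1.le, integral_smul_const, ← integral_Ioc_eq_integral_Ioo,
      ← intervalIntegral.integral_of_le hs.2.le, intervalIntegral.integral_deriv_eq_sub
      (fun x _ => (hθ.differentiable one_ne_zero).differentiableAt) (hc.intervalIntegrable _ _)]
  rw [e1, e2, hswap]

theorem exists_Icc_of_isCompact_subset_Ioo {K : Set ℝ} (hK : IsCompact K) (hKT : K ⊆ Ioo 0 T)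
    (hT : 0 < T) : ∃ a b, 0 < a ∧ b < T ∧ K ⊆ Icc a b := by
  rcases K.eq_empty_or_nonempty with rfl | hne
  · exact ⟨T, 0, hT, hT, empty_subset _⟩
  · exact ⟨sInf K, sSup K, (hKT (hK.sInf_mem hne)).1, (hKT (hK.sSup_mem hne)).2,
      fun x hx => ⟨csInf_le hK.bddBelow hx, le_csSup hK.bddAbove hx⟩⟩

/-- A smooth function with compact support in `(0,T)` and vanishing integral is the derivative of a
test function. -/
theorem exists_testFunction_deriv_eq (hT : 0 < T) {ζ : ℝ → ℝ} (hζ : ContDiff ℝ ∞ ζ)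
    (hc : HasCompactSupport ζ) (hs : tsupport ζ ⊆ Ioo 0 T) (h0 : ∫ x, ζ x = 0) :
    ∃ θ : 𝓓(interval 0 T, ℝ), deriv θ = ζ := by
  obtain ⟨a, b, ha, hb, hab⟩ := exists_Icc_of_isCompact_subset_Ioo hc hs hT
  have hz : ∀ x, x ∉ Icc a b → ζ x = 0 := fun x hx =>
    image_eq_zero_of_notMem_tsupport fun h => hx (hab h)
  have hd : ∀ t, HasDerivAt (fun t => ∫ s in (0 : ℝ)..t, ζ s) (ζ t) t := fun t =>
    intervalIntegral.integral_hasDerivAt_right (hζ.continuous.intervalIntegrable _ _)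
      (hζ.continuous.stronglyMeasurableAtFilter _ _) hζ.continuous.continuousAt
  have hderiv : deriv (fun t => ∫ s in (0 : ℝ)..t, ζ s) = ζ := funext fun t => (hd t).deriv
  have hsupp : Function.support (fun t => ∫ s in (0 : ℝ)..t, ζ s) ⊆ Icc a b := by
    intro t ht
    by_contra hn
    apply ht
    rw [mem_Icc, not_and_or, not_le, not_le] at hn
    dsimp only
    rcases hn with hn | hn
    · refine intervalIntegral.integral_zero_ae (Filter.Eventually.of_forall fun s hs' => ?_)
      refine hz s fun h => ?_
      exact absurd (hs'.2.trans_lt (max_lt ha hn)) (not_lt.2 h.1)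
    · rw [intervalIntegral.integral_eq_integral_of_support_subset, h0]
      intro s hs'
      have : s ∈ Icc a b := by
        by_contra h
        exact hs' (hz s h)
      exact ⟨ha.trans_le this.1, this.2.trans hn.le⟩
  refine ⟨⟨fun t => ∫ s in (0 : ℝ)..t, ζ s, ?_, ?_, ?_⟩, hderiv⟩
  · exact contDiff_infty_iff_deriv.2 ⟨fun t => (hd t).differentiableAt, by rwa [hderiv]⟩
  · exact HasCompactSupport.of_support_subset_isCompact isCompact_Icc hsupp
  · exact (closure_minimal hsupp isClosed_Icc).trans fun x hx =>
      ⟨ha.trans_le hx.1, hx.2.trans_lt hb⟩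

/-- The du Bois-Reymond lemma: an integrable function with vanishing weak derivative is constant. -/
theorem ae_eq_const_of_integral_deriv_smul_eq_zero [CompleteSpace E] (hT : 0 < T) {k : ℝ → E}
    (hk : Integrable k (leb 0 T))
    (h : ∀ θ : 𝓓(interval 0 T, ℝ), ∫ t in Ioo 0 T, deriv θ t • k t = 0) :
    ∃ c, k =ᵐ[leb 0 T] fun _ => c := by
  -- subtracting a multiple of the normed bump `χ` from a test function makes its integral vanish
  let χ : ContDiffBump (T / 2) := ⟨T / 8, T / 4, by positivity, by linarith⟩
  have hχs : tsupport (χ.normed volume) ⊆ Ioo 0 T := by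
    rw [χ.tsupport_normed_eq, Real.closedBall_eq_Icc]
    intro x hx
    have h1 := hx.1
    have h2 := hx.2
    simp only [χ] at h1 h2
    constructor <;> linarith
  refine ⟨∫ t in Ioo 0 T, χ.normed volume t • k t, ?_⟩
  set c := ∫ t in Ioo 0 T, χ.normed volume t • k t with hc
  have hsm : ∀ {ψ : ℝ → ℝ}, Continuous ψ → HasCompactSupport ψ →
      Integrable (fun t => ψ t • k t) (leb 0 T) := by
    intro ψ h1 h2
    obtain ⟨C, hC⟩ := h1.bounded_above_of_compact_support h2
    exact hk.bdd_smul C h1.aestronglyMeasurable (Filter.Eventually.of_forall hC)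
  have key : ∀ᵐ x, x ∈ Ioo 0 T → k x - c = 0 := by
    refine isOpen_Ioo.ae_eq_zero_of_integral_contDiff_smul_eq_zero
      (IntegrableOn.locallyIntegrableOn (hk.sub (integrable_const c))) fun ψ hψ hψc hψs => ?_
    set m := ∫ x, ψ x with hm
    have hζc : HasCompactSupport fun x => ψ x - m * χ.normed volume x :=
      hψc.sub (χ.hasCompactSupport_normed.mul_left)
    have hζs : tsupport (fun x => ψ x - m * χ.normed volume x) ⊆ Ioo 0 T := by
      refine (tsupport_sub _ _).trans (union_subset hψs ?_)
      exact (tsupport_mul_subset_right).trans hχs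
    obtain ⟨θ, hθ⟩ := exists_testFunction_deriv_eq hT
      (ζ := fun x => ψ x - m * χ.normed volume x)
      (hψ.sub (contDiff_const.mul χ.contDiff_normed)) hζc hζs (by
        rw [integral_sub (hψ.continuous.integrable_of_hasCompactSupport hψc)
          (χ.integrable_normed.const_mul m), integral_const_mul, χ.integral_normed]
        simp [hm])
    have h1 := h θ
    rw [hθ] at h1
    have h2 : ∫ t in Ioo 0 T, ψ t • k t = m • c := by
      have h5 : Integrable (fun t => m • χ.normed volume t • k t) (leb 0 T) :=
        (hsm (χ.contDiff_normed (n := 0)).continuous χ.hasCompactSupport_normed).smul m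
      rw [← sub_eq_zero, hc, ← integral_smul, ← integral_sub (hsm hψ.continuous hψc) h5, ← h1]
      refine integral_congr_ae (Filter.Eventually.of_forall fun t => ?_)
      simp only [sub_smul, mul_smul]
    have h3 : ∫ t in Ioo 0 T, ψ t = m :=
      setIntegral_eq_integral_of_forall_compl_eq_zero fun x hx =>
        image_eq_zero_of_notMem_tsupport fun h => hx (hψs h)
    have h4 : ∫ x, ψ x • (k x - c) = ∫ x in Ioo 0 T, ψ x • (k x - c) := by
      refine (setIntegral_eq_integral_of_forall_compl_eq_zero fun x hx => ?_).symm
      rw [image_eq_zero_of_notMem_tsupport fun h => hx (hψs h), zero_smul]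
    rw [h4]
    simp only [smul_sub]
    rw [integral_sub (hsm hψ.continuous hψc), h2, integral_smul_const, h3, sub_self]
    exact ((hψ.continuous.integrable_of_hasCompactSupport hψc).smul_const c).integrableOn
  rw [Filter.EventuallyEq, ae_restrict_iff' measurableSet_Ioo]
  filter_upwards [key] with x hx hm
  exact sub_eq_zero.1 (hx hm)

/-- A function with integrable weak derivative `g` is, up to a constant, the primitive of `g`. -/
theorem IsWeakTimeDeriv.exists_ae_eq_primitive [CompleteSpace E] (hT : 0 < T) {h g : ℝ → E}
    (hh : Integrable h (leb 0 T)) (hg : Integrable g (leb 0 T)) (H : IsWeakTimeDeriv T h g) :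
    ∃ c, h =ᵐ[leb 0 T] fun t => c + ∫ s in (0 : ℝ)..t, g s := by
  have hp : Integrable (fun t => ∫ s in (0 : ℝ)..t, g s) (leb 0 T) :=
    ((continuousOn_primitive_leb hT.le hg).integrableOn_Icc).mono_set Ioo_subset_Icc_self
  obtain ⟨c, hc⟩ := ae_eq_const_of_integral_deriv_smul_eq_zero hT (hh.sub hp) fun θ => by
    have hb : ∀ {f : ℝ → E}, Integrable f (leb 0 T) →
        Integrable (fun t => deriv θ t • f t) (leb 0 T) := by
      intro f hf
      have h1 := θ.contDiff.continuous_deriv (by simp)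
      obtain ⟨C, hC⟩ := h1.bounded_above_of_compact_support θ.hasCompactSupport.deriv
      exact hf.bdd_smul C h1.aestronglyMeasurable (Filter.Eventually.of_forall hC)
    have hT0 : θ T = 0 := image_eq_zero_of_notMem_tsupport fun h =>
      lt_irrefl _ (θ.tsupport_subset h).2
    simp only [Pi.sub_apply, smul_sub]
    rw [integral_sub (hb hh) (hb hp), H θ,
      integral_deriv_smul_primitive (θ.contDiff.of_le (by simp)) hg, hT0]
    simp [integral_neg]
  refine ⟨c, hc.mono fun t ht => ?_⟩
  exact sub_eq_iff_eq_add.1 ht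

end WeakDerivative

/-! ### The energy identity -/

section Energy

open Filter Topology

/-- Translations are continuous in `L²(ℝ;E)`. -/
theorem tendsto_eLpNorm_translate_sub {E : Type*} [NormedAddCommGroup E] {f : ℝ → E}
    (hf : MemLp f 2 volume) :
    Tendsto (fun s => eLpNorm (fun t => f (t + s) - f t) 2 volume) (𝓝 0) (𝓝 0) := by
  let G : C(ℝ, C(ℝ, ℝ)) := (ContinuousMap.mk (fun p : ℝ × ℝ => p.2 + p.1)
    (continuous_snd.add continuous_fst)).curry
  have hG : ∀ s, MeasurePreserving (G s) volume volume := fun s =>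
    measurePreserving_add_right volume s
  have h := (tendsto_const_nhds (x := hf.toLp f) (f := 𝓝 (0 : ℝ))).compMeasurePreservingLp
    (G.continuous.tendsto 0) hG (hG 0) (by norm_num)
  rw [Lp.tendsto_Lp_iff_tendsto_eLpNorm'] at h
  refine h.congr fun s => eLpNorm_congr_ae ?_
  have e0 : ∀ s, Lp.compMeasurePreserving (G s) (hG s) (hf.toLp f) =ᵐ[volume]
      fun t => f (t + s) := fun s => by
    rw [Lp.toLp_compMeasurePreserving hf (hG s)]
    exact (hf.comp_measurePreserving (hG s)).coeFn_toLp
  filter_upwards [e0 s, e0 0] with t h1 h2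
  rw [Pi.sub_apply, h1, h2, add_zero]

theorem lintegral_enorm_mul_enorm_le {E F α : Type*} [MeasurableSpace α] [NormedAddCommGroup E]
    [NormedAddCommGroup F] {μ : Measure α} {f : α → E} {g : α → F} (hf : AEStronglyMeasurable f μ)
    (hg : AEStronglyMeasurable g μ) :
    ∫⁻ t, ‖f t‖ₑ * ‖g t‖ₑ ∂μ ≤ eLpNorm f 2 μ * eLpNorm g 2 μ := by
  have := ENNReal.lintegral_mul_le_Lp_mul_Lq μ Real.HolderConjugate.two_two hf.enorm hg.enorm
  rw [eLpNorm_eq_lintegral_rpow_enorm_toReal (by norm_num) (by norm_num),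
    eLpNorm_eq_lintegral_rpow_enorm_toReal (by norm_num) (by norm_num)]
  simpa using this

/-- The double integral that bounds the increments over a time step `h` in the proof of the energy
identity: it is at most `h` times the `L²` norm of `g` times the modulus of continuity `ε` of `f` in
`L²` over translations by at most `h`. -/
theorem lintegral_translate_mul_le {E F : Type*} [NormedAddCommGroup E] [NormedAddCommGroup F]
    {f : ℝ → E} {g : ℝ → F} (hf : StronglyMeasurable f) (hg : StronglyMeasurable g) {h : ℝ}
    {ε : ℝ≥0∞} (hε : ∀ s ∈ Icc 0 h, eLpNorm (fun t => f (t + s) - f t) 2 volume ≤ ε) :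
    ∫⁻ t, ∫⁻ s in Ioc 0 h, ‖g (t + s)‖ₑ * (‖f (t + h) - f (t + s)‖ₑ + ‖f t - f (t + s)‖ₑ)
      ≤ ENNReal.ofReal h * (2 * eLpNorm g 2 volume * ε) := by
  have hm2 : ∀ s, Measurable fun t : ℝ => t + s := fun s => measurable_id.add_const s
  have m : ∀ s, StronglyMeasurable fun t => f (t + s) := fun s => hf.comp_measurable (hm2 s)
  have m' : ∀ s, StronglyMeasurable fun t => g (t + s) := fun s => hg.comp_measurable (hm2 s)
  have hp : Measurable fun z : ℝ × ℝ => z.1 + z.2 := measurable_fst.add measurable_snd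
  rw [lintegral_lintegral_swap]
  · have key : ∀ s ∈ Ioc 0 h,
        ∫⁻ t, ‖g (t + s)‖ₑ * (‖f (t + h) - f (t + s)‖ₑ + ‖f t - f (t + s)‖ₑ)
          ≤ 2 * eLpNorm g 2 volume * ε := by
      intro s hs
      have eg : eLpNorm (fun t => g (t + s)) 2 volume = eLpNorm g 2 volume :=
        eLpNorm_comp_measurePreserving (p := 2) hg.aestronglyMeasurable
          (measurePreserving_add_right volume s)
      have e1 : eLpNorm (fun t => f (t + h) - f (t + s)) 2 volume ≤ ε := by
        have := eLpNorm_comp_measurePreserving (p := 2) (g := fun t => f (t + (h - s)) - f t)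
          ((m (h - s)).sub hf).aestronglyMeasurable (measurePreserving_add_right volume s)
        refine le_trans (le_of_eq ?_) (hε (h - s) ⟨sub_nonneg.2 hs.2, by linarith [hs.1]⟩)
        rw [← this]
        congr 1
        ext t
        simp only [Function.comp]
        ring_nf
      have e2 : eLpNorm (fun t => f t - f (t + s)) 2 volume ≤ ε := by
        refine le_trans (le_of_eq ?_) (hε s ⟨hs.1.le, hs.2⟩)
        exact eLpNorm_sub_comm _ _ _ _
      simp only [mul_add]
      have e3 : Measurable fun t => ‖g (t + s)‖ₑ * ‖f (t + h) - f (t + s)‖ₑ :=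
        (m' s).enorm.mul ((m h).sub (m s)).enorm
      rw [lintegral_add_left e3]
      calc _ ≤ eLpNorm g 2 volume * ε + eLpNorm g 2 volume * ε := by
            gcongr
            · refine (lintegral_enorm_mul_enorm_le (m' s).aestronglyMeasurable
                ((m h).sub (m s)).aestronglyMeasurable).trans ?_
              rw [eg]
              exact mul_le_mul_right e1 _
            · refine (lintegral_enorm_mul_enorm_le (m' s).aestronglyMeasurable
                (hf.sub (m s)).aestronglyMeasurable).trans ?_
              rw [eg]
              exact mul_le_mul_right e2 _
        _ = _ := by ring
    refine (setLIntegral_mono measurable_const key).trans (le_of_eq ?_)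
    rw [setLIntegral_const, Real.volume_Ioc, sub_zero, mul_comm]
  · have e1 : Measurable fun z : ℝ × ℝ => ‖f (z.1 + h) - f (z.1 + z.2)‖ₑ :=
      ((hf.comp_measurable (measurable_fst.add_const h)).sub (hf.comp_measurable hp)).enorm
    have e2 : Measurable fun z : ℝ × ℝ => ‖f z.1 - f (z.1 + z.2)‖ₑ :=
      ((hf.comp_measurable measurable_fst).sub (hf.comp_measurable hp)).enorm
    exact (((hg.comp_measurable hp).enorm).mul (e1.add e2)).aemeasurable

/-- If the increments of `F` over a time step `h`, tested against `θ`, are `o(h)`, then the weak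
derivative of `F` tested against `θ` vanishes. -/
theorem integral_mul_deriv_eq_zero_of_isLittleO {F θ : ℝ → ℝ} (hF : Integrable F)
    (hθ : ContDiff ℝ 1 θ) (hθc : HasCompactSupport θ)
    (h : (fun h => ∫ t, (F (t + h) - F t) * θ t) =o[𝓝[>] 0] fun h => h) :
    ∫ t, F t * deriv θ t = 0 := by
  have hc : Continuous (deriv θ) := hθ.continuous_deriv le_rfl
  obtain ⟨C, hC⟩ := hc.bounded_above_of_compact_support hθc.deriv
  obtain ⟨C', hC'⟩ := hθ.continuous.bounded_above_of_compact_support hθc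
  have hb : ∀ {G φ : ℝ → ℝ} {K : ℝ}, Integrable G → Continuous φ → (∀ x, ‖φ x‖ ≤ K) →
      Integrable fun t => G t * φ t := fun hG h1 h2 =>
    hG.mul_bdd h1.aestronglyMeasurable (Eventually.of_forall h2)
  have hd := (hasDerivAt_integral_of_dominated_loc_of_deriv_le (μ := volume) (x₀ := (0 : ℝ))
    (F := fun h t => F t * θ (t - h)) (F' := fun h t => F t * (-deriv θ (t - h)))
    (bound := fun t => ‖F t‖ * C) (s := univ) univ_mem
    (Eventually.of_forall fun h => (hb hF (hθ.continuous.comp (continuous_id.sub continuous_const))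
      fun x => hC' _).aestronglyMeasurable)
    (hb hF (hθ.continuous.comp (continuous_id.sub continuous_const)) fun x => hC' _)
    (hb hF (hc.comp (continuous_id.sub continuous_const)).neg
      fun x => (norm_neg _).trans_le (hC _)).aestronglyMeasurable
    (Eventually.of_forall fun t h _ => by
      rw [norm_mul, norm_neg]
      exact mul_le_mul_of_nonneg_left (hC _) (norm_nonneg _))
    (hF.norm.mul_const C)
    (Eventually.of_forall fun t h _ => by
      have h1 : HasDerivAt θ (deriv θ (t - h)) (t - h) :=
        (hθ.differentiable one_ne_zero _).hasDerivAt
      have h2 := h1.comp_const_sub t h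
      exact h2.const_mul (F t))).2
  have h0 : HasDerivWithinAt (fun h => ∫ t, F t * θ (t - h)) 0 (Ioi 0) 0 := by
    rw [hasDerivWithinAt_iff_isLittleO]
    refine h.congr (fun x => ?_) fun x => by simp
    have e1 : ∫ t, F t * θ (t - x) = ∫ t, F (t + x) * θ t := by
      rw [← integral_add_right_eq_self _ x]
      simp
    rw [e1, sub_zero, smul_zero, sub_zero]
    simp only [sub_mul, sub_zero]
    exact integral_sub (hb (hF.comp_add_right x) hθ.continuous hC') (hb hF hθ.continuous hC')
  have := (uniqueDiffWithinAt_Ioi (0 : ℝ)).eq_deriv _ hd.hasDerivWithinAt h0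
  simpa [integral_neg] using this

variable {E H : Type*} [NormedAddCommGroup E] [NormedSpace ℝ E]
  [NormedAddCommGroup H] [InnerProductSpace ℝ H] {j : E →L[ℝ] H} {T : ℝ}
  {ρ : ℝ → E} {g : ℝ → StrongDual ℝ E}

theorem toDual_apply (j : E →L[ℝ] H) (x y : E) : toDual j x y = inner ℝ (j x) (j y) := rfl

theorem MemLp.integrable_leb {F : Type*} [NormedAddCommGroup F] {f : ℝ → F}
    (hf : MemLp f 2 (leb 0 T)) : Integrable f (leb 0 T) :=
  hf.integrable (by norm_num)

theorem memLp_indicator_leb {F : Type*} [NormedAddCommGroup F] {f : ℝ → F}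
    (hf : MemLp f 2 (leb 0 T)) : MemLp ((Ioo 0 T).indicator f) 2 volume :=
  (memLp_indicator_iff_restrict measurableSet_Ioo).2 hf

theorem integrable_dual_apply {α : Type*} [MeasurableSpace α] {μ : Measure α} {f : α → E}
    {g : α → StrongDual ℝ E} (hg : MemLp g 2 μ) (hf : MemLp f 2 μ) :
    Integrable (fun t => g t (f t)) μ := by
  refine (hg.norm.integrable_mul hf.norm).mono' ?_ (Eventually.of_forall fun t => ?_)
  · exact isBoundedBilinearMap_apply.continuous.comp_aestronglyMeasurable₂
      hg.aestronglyMeasurable hf.aestronglyMeasurable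
  · exact (g t).le_opNorm (f t)

theorem inner_sub_inner_eq_integral {c : StrongDual ℝ E} (hg : Integrable g (leb 0 T)) {a b : ℝ}
    (ha : a ∈ Icc 0 T) (hb : b ∈ Icc 0 T)
    (ha' : toDual j (ρ a) = c + ∫ s in (0 : ℝ)..a, g s)
    (hb' : toDual j (ρ b) = c + ∫ s in (0 : ℝ)..b, g s) (v : E) :
    inner ℝ (j (ρ b)) (j v) - inner ℝ (j (ρ a)) (j v) = ∫ s in a..b, g s v := by
  have h0 : (0 : ℝ) ∈ Icc 0 T := ⟨le_rfl, ha.1.trans ha.2⟩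
  rw [← toDual_apply, ← toDual_apply, ← sub_apply, ha', hb',
    add_sub_add_left_eq_sub, intervalIntegral.integral_interval_sub_left
      (intervalIntegrable_of_leb hg h0 hb) (intervalIntegrable_of_leb hg h0 ha),
    ContinuousLinearMap.intervalIntegral_apply (intervalIntegrable_of_leb hg ha hb)]

/-- The increment of `‖ρ‖²_H` is that of the linear function `(ρ, v)_H` for `v = ρ(b) + ρ(a)`. -/
theorem norm_sq_sub_norm_sq_eq_integral {c : StrongDual ℝ E} (hg : Integrable g (leb 0 T))
    {a b : ℝ} (ha : a ∈ Icc 0 T) (hb : b ∈ Icc 0 T)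
    (ha' : toDual j (ρ a) = c + ∫ s in (0 : ℝ)..a, g s)
    (hb' : toDual j (ρ b) = c + ∫ s in (0 : ℝ)..b, g s) :
    ‖j (ρ b)‖ ^ 2 - ‖j (ρ a)‖ ^ 2 = ∫ s in a..b, g s (ρ b + ρ a) := by
  rw [← inner_sub_inner_eq_integral hg ha hb ha' hb', ← real_inner_self_eq_norm_sq,
    ← real_inner_self_eq_norm_sq, map_add, inner_add_right, inner_add_right,
    real_inner_comm (j (ρ a)) (j (ρ b))]
  ring

/-- The increments of `‖ρ‖²_H - 2∫⟨g,ρ⟩` involve only differences of values of `ρ`. -/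
theorem energy_defect_sub_eq_integral (hT : 0 ≤ T) {c : StrongDual ℝ E}
    (hgi : Integrable g (leb 0 T)) (hgρ : Integrable (fun s => g s (ρ s)) (leb 0 T)) {t h : ℝ}
    (htI : t ∈ Icc 0 T) (hthI : t + h ∈ Icc 0 T)
    (h1 : toDual j (ρ t) = c + ∫ s in (0 : ℝ)..t, g s)
    (h2 : toDual j (ρ (t + h)) = c + ∫ s in (0 : ℝ)..(t + h), g s) :
    (‖j (ρ (t + h))‖ ^ 2 - 2 * ∫ s in (0 : ℝ)..(t + h), g s (ρ s))
      - (‖j (ρ t)‖ ^ 2 - 2 * ∫ s in (0 : ℝ)..t, g s (ρ s))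
      = ∫ s in (0 : ℝ)..h, g (t + s) ((ρ (t + h) - ρ (t + s)) + (ρ t - ρ (t + s))) := by
  have h0 : (0 : ℝ) ∈ Icc 0 T := ⟨le_rfl, hT⟩
  have e1 := norm_sq_sub_norm_sq_eq_integral hgi htI hthI h1 h2
  have i1 : IntervalIntegrable (fun s => g s (ρ (t + h) + ρ t)) volume t (t + h) := by
    have := intervalIntegrable_of_leb hgi htI hthI
    exact ⟨this.1.apply_continuousLinearMap _, this.2.apply_continuousLinearMap _⟩
  have i2 := intervalIntegrable_of_leb hgρ htI hthI
  have e3 : (‖j (ρ (t + h))‖ ^ 2 - 2 * ∫ s in (0 : ℝ)..(t + h), g s (ρ s))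
      - (‖j (ρ t)‖ ^ 2 - 2 * ∫ s in (0 : ℝ)..t, g s (ρ s)) = (∫ s in t..(t + h), g s (ρ (t + h) + ρ t))
      - 2 * ∫ s in t..(t + h), g s (ρ s) := by
    rw [← e1, ← intervalIntegral.integral_interval_sub_left
      (intervalIntegrable_of_leb hgρ h0 hthI) (intervalIntegrable_of_leb hgρ h0 htI)]
    ring
  rw [e3, ← intervalIntegral.integral_const_mul, ← intervalIntegral.integral_sub i1
    (i2.const_mul 2)]
  have := intervalIntegral.integral_comp_add_left (a := 0) (b := h)
    (fun s => g s ((ρ (t + h) - ρ s) + (ρ t - ρ s))) t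
  rw [this, add_zero]
  refine intervalIntegral.integral_congr fun s _ => ?_
  simp only [map_add, map_sub]
  ring

/-- The energy identity: for `ρ ∈ L²(0,T;E)` with weak time derivative `g ∈ L²(0,T;E*)`,
`‖ρ(t)‖²_H` is up to a constant the primitive of `2⟨g,ρ⟩`. The increments over a time step `h` of
the difference of the two sides are controlled by those of `ρ` in `L²(ℝ;E)`, hence are `o(h)`. -/
theorem exists_energy_identity (hT : 0 < T) (hρm : StronglyMeasurable ρ) (hgm : StronglyMeasurable g)
    (hρ : MemLp ρ 2 (leb 0 T)) (hg : MemLp g 2 (leb 0 T)) {c : StrongDual ℝ E}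
    (hc : ∀ᵐ t ∂leb 0 T, toDual j (ρ t) = c + ∫ s in (0 : ℝ)..t, g s) :
    ∃ c₀ : ℝ, ∀ᵐ t ∂leb 0 T, ‖j (ρ t)‖ ^ 2 = c₀ + 2 * ∫ s in (0 : ℝ)..t, g s (ρ s) := by
  have hgi := MemLp.integrable_leb hg
  have hgρ := integrable_dual_apply hg hρ
  set F : ℝ → ℝ := fun t => ‖j (ρ t)‖ ^ 2 - 2 * ∫ s in (0 : ℝ)..t, g s (ρ s) with hF
  have hFi : Integrable F (leb 0 T) := by
    have h1 : Integrable (fun t => ‖j (ρ t)‖ ^ 2) (leb 0 T) :=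
      (memLp_two_iff_integrable_sq_norm (j.comp_memLp' hρ).aestronglyMeasurable).1
        (j.comp_memLp' hρ)
    exact h1.sub <| (((continuousOn_primitive_leb hT.le hgρ).integrableOn_Icc).mono_set
      Ioo_subset_Icc_self).const_mul 2
  suffices h : ∃ c₀, F =ᵐ[leb 0 T] fun _ => c₀ by
    obtain ⟨c₀, h⟩ := h
    exact ⟨c₀, h.mono fun t ht => sub_eq_iff_eq_add.1 ht⟩
  have hdBR := ae_eq_const_of_integral_deriv_smul_eq_zero hT hFi
  refine hdBR fun θ => ?_
  set F' := (Ioo 0 T).indicator F with hF'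
  set ρ' := (Ioo 0 T).indicator ρ with hρ'
  set g' := (Ioo 0 T).indicator g with hg'
  have hρ'L : MemLp ρ' 2 volume := memLp_indicator_leb hρ
  have hg'L : MemLp g' 2 volume := memLp_indicator_leb hg
  have hF'i : Integrable F' := by
    rw [hF', integrable_indicator_iff measurableSet_Ioo]
    exact hFi
  have e0 : ∫ t in Ioo 0 T, deriv θ t • F t = ∫ t, F' t * deriv θ t := by
    rw [← integral_indicator measurableSet_Ioo]
    congr 1
    ext t
    by_cases ht : t ∈ Ioo 0 T
    · rw [hF', indicator_of_mem ht, indicator_of_mem ht, smul_eq_mul, mul_comm]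
    · rw [hF', indicator_of_notMem ht, indicator_of_notMem ht, zero_mul]
  rw [e0]
  refine integral_mul_deriv_eq_zero_of_isLittleO hF'i (θ.contDiff.of_le (by simp))
    θ.hasCompactSupport ?_
  obtain ⟨a, b, ha, hb, hab⟩ :=
    exists_Icc_of_isCompact_subset_Ioo θ.hasCompactSupport θ.tsupport_subset hT
  obtain ⟨C, hC⟩ := θ.continuous.bounded_above_of_compact_support θ.hasCompactSupport
  have hC0 : 0 ≤ C := (norm_nonneg _).trans (hC 0)
  set M := (eLpNorm g' 2 volume).toReal with hM
  have hM0 : 0 ≤ M := ENNReal.toReal_nonneg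
  have hMe : eLpNorm g' 2 volume = ENNReal.ofReal M := (ENNReal.ofReal_toReal hg'L.2.ne).symm
  rw [Asymptotics.isLittleO_iff]
  intro ε hε
  -- the increments will be bounded by `2 C M h` times the modulus of continuity of `ρ` in `L²`
  set ε' := ε / (2 * C * M + 1) with hε'
  have hε'0 : 0 < ε' := by positivity
  obtain ⟨δ, hδ, hδ'⟩ := Metric.eventually_nhds_iff.1
    ((ENNReal.tendsto_nhds_zero.1 (tendsto_eLpNorm_translate_sub hρ'L))
      (ENNReal.ofReal ε') (by simpa using hε'0))
  have hpos : 0 < min δ (T - b) := lt_min hδ (sub_pos.2 hb)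
  filter_upwards [Ioo_mem_nhdsGT hpos] with h hh
  have hh0 : 0 < h := hh.1
  have hhδ : h < δ := hh.2.trans_le (min_le_left _ _)
  have hhb : h < T - b := hh.2.trans_le (min_le_right _ _)
  have hc' : ∀ᵐ t, t ∈ Ioo 0 T → toDual j (ρ t) = c + ∫ s in (0 : ℝ)..t, g s :=
    (ae_restrict_iff' measurableSet_Ioo).1 hc
  have hc'' := (measurePreserving_add_right volume h).quasiMeasurePreserving.ae hc'
  -- the increments of `F`, for `t` in the support of `θ`
  have key : ∀ᵐ t, ‖(F' (t + h) - F' t) * θ t‖ₑ ≤ ENNReal.ofReal C *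
      ∫⁻ s in Ioc 0 h, ‖g' (t + s)‖ₑ * (‖ρ' (t + h) - ρ' (t + s)‖ₑ + ‖ρ' t - ρ' (t + s)‖ₑ) := by
    filter_upwards [hc', hc''] with t h1 h2
    by_cases htab : t ∈ Icc a b
    · have ht : t ∈ Ioo 0 T := ⟨ha.trans_le htab.1, htab.2.trans_lt hb⟩
      have hth : t + h ∈ Ioo 0 T := ⟨by linarith [ht.1], by linarith [htab.2]⟩
      have hts : ∀ s ∈ Ioc 0 h, t + s ∈ Ioo 0 T := fun s hs =>
        ⟨by linarith [ht.1, hs.1], by linarith [hs.2, hth.2]⟩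
      have e2 := energy_defect_sub_eq_integral hT.le hgi hgρ (Ioo_subset_Icc_self ht)
        (Ioo_subset_Icc_self hth) (h1 ht) (h2 hth)
      have e4 : F' (t + h) - F' t = F (t + h) - F t := by
        simp only [hF', indicator_of_mem ht, indicator_of_mem hth]
      rw [enorm_mul, mul_comm, e4, e2, intervalIntegral.integral_of_le hh0.le]
      gcongr
      · rw [← ofReal_norm]
        exact ENNReal.ofReal_le_ofReal (hC t)
      · refine (enorm_integral_le_lintegral_enorm _).trans
          (setLIntegral_mono' measurableSet_Ioc fun s hs => ?_)
        simp only [hρ', hg', indicator_of_mem ht, indicator_of_mem hth, indicator_of_mem (hts s hs)]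
        refine ((g (t + s)).le_opENorm _).trans ?_
        gcongr
        exact enorm_add_le _ _
    · rw [image_eq_zero_of_notMem_tsupport fun h => htab (hab h)]
      simp
  have hle : ∫⁻ t, ‖(F' (t + h) - F' t) * θ t‖ₑ ≤ ENNReal.ofReal (ε * h) := by
    refine (lintegral_mono_ae key).trans ?_
    rw [lintegral_const_mul' _ _ ENNReal.ofReal_ne_top]
    have hω : ∀ s ∈ Icc 0 h,
        eLpNorm (fun t => ρ' (t + s) - ρ' t) 2 volume ≤ ENNReal.ofReal ε' := by
      intro s hs
      refine hδ' ?_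
      rw [Real.dist_eq, sub_zero, abs_of_nonneg hs.1]
      exact hs.2.trans_lt hhδ
    have h3 := lintegral_translate_mul_le (f := ρ') (g := g') (hρm.indicator measurableSet_Ioo)
      (hgm.indicator measurableSet_Ioo) hω
    refine (mul_le_mul_right h3 _).trans ?_
    · rw [hMe, ← ENNReal.ofReal_ofNat 2, ← ENNReal.ofReal_mul (by norm_num),
        ← ENNReal.ofReal_mul (by positivity), ← ENNReal.ofReal_mul hh0.le,
        ← ENNReal.ofReal_mul hC0]
      refine ENNReal.ofReal_le_ofReal ?_
      have : ε = ε' * (2 * C * M + 1) := by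
        rw [hε']; field_simp
      calc C * (h * (2 * M * ε')) = (ε' * (2 * C * M)) * h := by ring
        _ ≤ ε * h := by
          rw [this]
          gcongr
          linarith
  have := (enorm_integral_le_lintegral_enorm _).trans hle
  rw [← ofReal_norm, ENNReal.ofReal_le_ofReal_iff (by positivity)] at this
  rwa [Real.norm_of_nonneg hh0.le]

end Energy

/-! ### The continuous representative -/

section Representative

open Filter Topology

variable {E H : Type*} [NormedAddCommGroup E] [NormedSpace ℝ E]
  [NormedAddCommGroup H] [InnerProductSpace ℝ H] {j : E →L[ℝ] H} {T : ℝ}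
  {ρ : ℝ → E} {g : ℝ → StrongDual ℝ E}

theorem integrable_norm_dual_mul_norm {α : Type*} [MeasurableSpace α] {μ : Measure α} {f : α → E}
    {g : α → StrongDual ℝ E} (hg : MemLp g 2 μ) (hf : MemLp f 2 μ) :
    Integrable (fun t => ‖g t‖ * ‖f t‖) μ :=
  hg.norm.integrable_mul hf.norm

theorem mem_closure_of_ae_leb (hT : 0 < T) {p : ℝ → Prop} (hp : ∀ᵐ t ∂leb 0 T, p t) {x : ℝ}
    (hx : x ∈ Icc 0 T) : x ∈ closure {t | t ∈ Ioo 0 T ∧ p t} := by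
  have h1 : Dense {t | t ∈ Ioo 0 T → p t} :=
    Measure.dense_of_ae ((ae_restrict_iff' measurableSet_Ioo).1 hp)
  have h2 := closure_mono (h1.open_subset_closure_inter (isOpen_Ioo (a := (0 : ℝ)) (b := T)))
  rw [closure_closure, closure_Ioo hT.ne] at h2
  refine closure_mono ?_ (h2 hx)
  exact fun t ht => ⟨ht.1, ht.2 ht.1⟩

/-- Some value of `‖f‖`, taken in a given set of full measure, is at most the mean of `‖f‖` with
respect to the weight `‖g‖`. -/
theorem exists_norm_mul_integral_le {E F : Type*} [NormedAddCommGroup E] [NormedAddCommGroup F]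
    {f : ℝ → E} {g : ℝ → F} {s t : ℝ} (hst : s < t) (hg : Integrable g (volume.restrict (Ioo s t)))
    (hgf : Integrable (fun x => ‖g x‖ * ‖f x‖) (volume.restrict (Ioo s t))) {p : ℝ → Prop}
    (hp : ∀ᵐ x ∂(volume.restrict (Ioo s t)), p x) :
    ∃ a ∈ Ioo s t, p a ∧ ‖f a‖ * ∫ x in Ioo s t, ‖g x‖ ≤ ∫ x in Ioo s t, ‖g x‖ * ‖f x‖ := by
  set G := ∫ x in Ioo s t, ‖g x‖ with hG
  set P := ∫ x in Ioo s t, ‖g x‖ * ‖f x‖ with hP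
  have hP0 : 0 ≤ P := integral_nonneg fun x => by positivity
  by_contra! hcon
  have hae : ∀ᵐ x ∂(volume.restrict (Ioo s t)), P < ‖f x‖ * G := by
    filter_upwards [hp, ae_restrict_mem measurableSet_Ioo] with x h1 h2
    exact hcon x h2 h1
  have hne : (ae (volume.restrict (Ioo s t))).NeBot := by
    rw [ae_neBot, Ne, Measure.restrict_eq_zero, Real.volume_Ioo]
    simpa using hst
  have hi : Integrable (fun x => ‖g x‖ * (‖f x‖ * G - P)) (volume.restrict (Ioo s t)) := by
    refine ((hgf.mul_const G).sub (hg.norm.mul_const P)).congr (Eventually.of_forall fun x => ?_)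
    simp only [Pi.sub_apply]
    ring
  have h0 : ∫ x in Ioo s t, ‖g x‖ * (‖f x‖ * G - P) = 0 := by
    have : ∀ x, ‖g x‖ * (‖f x‖ * G - P) = ‖g x‖ * ‖f x‖ * G - ‖g x‖ * P := fun x => by ring
    simp only [this]
    rw [integral_sub (hgf.mul_const G) (hg.norm.mul_const P), integral_mul_const,
      integral_mul_const, ← hP, ← hG]
    ring
  rw [integral_eq_zero_iff_of_nonneg_ae (hae.mono fun x hx =>
    mul_nonneg (norm_nonneg _) (sub_nonneg.2 hx.le)) hi] at h0
  have hg0 : G = 0 := by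
    rw [hG]
    refine integral_eq_zero_of_ae ?_
    filter_upwards [h0, hae] with x h1 h2
    exact (mul_eq_zero.1 h1).resolve_right (sub_pos.2 h2).ne'
  obtain ⟨x, hx⟩ := hae.exists
  rw [hg0, mul_zero] at hx
  exact absurd hx (not_lt.2 hP0)

/-- If the equation for `ρ` and the energy identity hold at the times `a` and `b`, then they
determine `‖ρ(b) - ρ(a)‖²_H` in terms of `g`, `ρ` and the single value `ρ(a)`. -/
theorem norm_sub_sq_eq_integral {c : StrongDual ℝ E} {c₀ : ℝ} (hT : 0 ≤ T)
    (hg : Integrable g (leb 0 T)) (hgρ : Integrable (fun s => g s (ρ s)) (leb 0 T))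
    {a b : ℝ} (ha : a ∈ Icc 0 T) (hb : b ∈ Icc 0 T)
    (ha' : toDual j (ρ a) = c + ∫ s in (0 : ℝ)..a, g s)
    (hb' : toDual j (ρ b) = c + ∫ s in (0 : ℝ)..b, g s)
    (ha₂ : ‖j (ρ a)‖ ^ 2 = c₀ + 2 * ∫ s in (0 : ℝ)..a, g s (ρ s))
    (hb₂ : ‖j (ρ b)‖ ^ 2 = c₀ + 2 * ∫ s in (0 : ℝ)..b, g s (ρ s)) :
    ‖j (ρ b) - j (ρ a)‖ ^ 2 = 2 * (∫ s in a..b, g s (ρ s)) - 2 * ∫ s in a..b, g s (ρ a) := by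
  have h0 : (0 : ℝ) ∈ Icc 0 T := ⟨le_rfl, hT⟩
  rw [← inner_sub_inner_eq_integral hg ha hb ha' hb' (ρ a),
    ← intervalIntegral.integral_interval_sub_left (intervalIntegrable_of_leb hgρ h0 hb)
      (intervalIntegrable_of_leb hgρ h0 ha), norm_sub_sq_real, real_inner_self_eq_norm_sq]
  linarith

/-- A modulus of continuity in `H`: the energy identity is used between each of the two endpoints
and an intermediate time at which the `E`-norm of `ρ` is not too large. -/
theorem dist_le_of_energy_identity {c : StrongDual ℝ E} {c₀ : ℝ} (hT : 0 < T)
    (hρ : MemLp ρ 2 (leb 0 T)) (hg : MemLp g 2 (leb 0 T)) {p : ℝ → Prop}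
    (hp : ∀ᵐ t ∂leb 0 T, p t)
    (hc : ∀ t, p t → toDual j (ρ t) = c + ∫ s in (0 : ℝ)..t, g s)
    (hc₀ : ∀ t, p t → ‖j (ρ t)‖ ^ 2 = c₀ + 2 * ∫ s in (0 : ℝ)..t, g s (ρ s))
    {s t : ℝ} (hs : s ∈ Icc 0 T) (ht : t ∈ Icc 0 T) (hst : s < t) (hps : p s) (hpt : p t) :
    dist (j (ρ t)) (j (ρ s)) ≤ 4 * √(∫ x in s..t, ‖g x‖ * ‖ρ x‖) := by
  have hgi := MemLp.integrable_leb hg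
  have hgρ := integrable_dual_apply hg hρ
  have hgn := integrable_norm_dual_mul_norm hg hρ
  have hsub : Ioo s t ⊆ Ioo 0 T := Ioo_subset_Ioo hs.1 ht.2
  obtain ⟨a, ha, hpa, hle⟩ := exists_norm_mul_integral_le hst (IntegrableOn.mono_set hgi hsub)
    (IntegrableOn.mono_set hgn hsub) (ae_restrict_of_ae_restrict_of_subset hsub hp)
  rw [← integral_Ioc_eq_integral_Ioo, ← integral_Ioc_eq_integral_Ioo,
    ← intervalIntegral.integral_of_le hst.le, ← intervalIntegral.integral_of_le hst.le] at hle
  have haT : a ∈ Icc 0 T := Ioo_subset_Icc_self (hsub ha)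
  have key : ∀ b ∈ Icc s t, b ∈ Icc 0 T → p b →
      ‖j (ρ b) - j (ρ a)‖ ≤ 2 * √(∫ x in s..t, ‖g x‖ * ‖ρ x‖) := by
    intro b hb hbT hpb
    have h1 := norm_sub_sq_eq_integral hT.le hgi hgρ haT hbT (hc a hpa) (hc b hpb) (hc₀ a hpa)
      (hc₀ b hpb)
    have hsubI : uIoc a b ⊆ uIoc s t := by
      rw [uIoc_of_le hst.le]
      rcases le_total a b with hab | hab
      · rw [uIoc_of_le hab]; exact Ioc_subset_Ioc ha.1.le hb.2
      · rw [uIoc_of_ge hab]; exact Ioc_subset_Ioc hb.1 ha.2.le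
    have i1 := intervalIntegrable_of_leb hgn hs ht
    have i2 := (intervalIntegrable_of_leb hgi hs ht).norm
    have mono : ∀ {f : ℝ → ℝ}, IntervalIntegrable f volume s t → (∀ x, 0 ≤ f x) →
        ∫ x in uIoc a b, f x ≤ ∫ x in s..t, f x := by
      intro f hf h0
      rw [intervalIntegral.integral_of_le hst.le, ← uIoc_of_le hst.le]
      exact setIntegral_mono_set (intervalIntegrable_iff.1 hf) (Eventually.of_forall h0)
        hsubI.eventuallyLE
    have b1 : |∫ x in a..b, g x (ρ x)| ≤ ∫ x in s..t, ‖g x‖ * ‖ρ x‖ := by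
      rw [← Real.norm_eq_abs]
      refine (intervalIntegral.norm_integral_le_integral_norm_uIoc).trans
        (le_trans ?_ (mono i1 fun x => by positivity))
      refine setIntegral_mono_on ?_ ((intervalIntegrable_iff.1 i1).mono_set hsubI)
        measurableSet_uIoc fun x _ => (g x).le_opNorm _
      exact (intervalIntegrable_iff.1 (intervalIntegrable_of_leb hgρ haT hbT)).norm
    have b2 : |∫ x in a..b, g x (ρ a)| ≤ ∫ x in s..t, ‖g x‖ * ‖ρ x‖ := by
      refine le_trans ?_ hle
      rw [← Real.norm_eq_abs]
      refine (intervalIntegral.norm_integral_le_integral_norm_uIoc).trans ?_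
      rw [← intervalIntegral.integral_const_mul]
      refine le_trans ?_ (mono (i2.const_mul _) fun x => by positivity)
      refine setIntegral_mono_on ?_ ((intervalIntegrable_iff.1 (i2.const_mul _)).mono_set hsubI)
        measurableSet_uIoc fun x _ => ?_
      · exact ((intervalIntegrable_iff.1 (intervalIntegrable_of_leb hgi haT
          hbT)).apply_continuousLinearMap _).norm
      · rw [mul_comm]
        exact (g x).le_opNorm _
    refine abs_le_of_sq_le_sq' ?_ (by positivity) |>.2
    rw [h1, mul_pow, Real.sq_sqrt ((abs_nonneg _).trans b1)]
    linarith [abs_le.1 b1, abs_le.1 b2]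
  have h1 := key t ⟨hst.le, le_rfl⟩ ht hpt
  have h2 := key s ⟨le_rfl, hst.le⟩ hs hps
  calc dist (j (ρ t)) (j (ρ s)) ≤ dist (j (ρ t)) (j (ρ a)) + dist (j (ρ s)) (j (ρ a)) :=
        dist_triangle_right _ _ _
    _ ≤ _ := by
      rw [dist_eq_norm, dist_eq_norm]
      linarith

/-- A function in `L²(0,T;E)` with weak time derivative in `L²(0,T;E*)` has a representative in
`C([0,T];H)`. -/
theorem exists_continuousMap_ae_eq [CompleteSpace H] (hT : 0 < T) (hρm : StronglyMeasurable ρ)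
    (hgm : StronglyMeasurable g) (hρ : MemLp ρ 2 (leb 0 T)) (hg : MemLp g 2 (leb 0 T))
    {c : StrongDual ℝ E} (hc : ∀ᵐ t ∂leb 0 T, toDual j (ρ t) = c + ∫ s in (0 : ℝ)..t, g s) :
    ∃ r : C(Icc 0 T, H), ∀ᵐ t ∂leb 0 T, ∀ ht : t ∈ Icc 0 T, r ⟨t, ht⟩ = j (ρ t) := by
  obtain ⟨c₀, hc₀⟩ := exists_energy_identity hT hρm hgm hρ hg hc
  have hgn := integrable_norm_dual_mul_norm hg hρ
  set p : ℝ → Prop := fun t => toDual j (ρ t) = c + (∫ s in (0 : ℝ)..t, g s) ∧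
    ‖j (ρ t)‖ ^ 2 = c₀ + 2 * ∫ s in (0 : ℝ)..t, g s (ρ s) with hp
  have hpae : ∀ᵐ t ∂leb 0 T, p t := by
    filter_upwards [hc, hc₀] with t h1 h2 using ⟨h1, h2⟩
  set P : ℝ → ℝ := fun t => ∫ x in (0 : ℝ)..t, ‖g x‖ * ‖ρ x‖ with hP
  have hPu : UniformContinuousOn P (Icc 0 T) :=
    isCompact_Icc.uniformContinuousOn_of_continuous (continuousOn_primitive_leb hT.le hgn)
  let S : Set (Icc 0 T) := {t | p t}
  have hS : Dense S := by
    intro x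
    rw [closure_subtype]
    refine closure_mono ?_ (mem_closure_of_ae_leb hT hpae x.2)
    exact fun t ht => ⟨⟨t, Ioo_subset_Icc_self ht.1⟩, ht.2, rfl⟩
  have hdist : ∀ s t : S, dist (j (ρ s)) (j (ρ t)) ≤ 4 * √|P s - P t| := by
    have h0 : (0 : ℝ) ∈ Icc 0 T := ⟨le_rfl, hT.le⟩
    have aux : ∀ s t : S, (s : ℝ) < t → dist (j (ρ t)) (j (ρ s)) ≤ 4 * √|P t - P s| := by
      intro s t hst
      have h1 := dist_le_of_energy_identity hT hρ hg hpae (fun t h => h.1) (fun t h => h.2)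
        s.1.2 t.1.2 hst s.2 t.2
      refine h1.trans ?_
      rw [← intervalIntegral.integral_interval_sub_left (intervalIntegrable_of_leb hgn h0 t.1.2)
        (intervalIntegrable_of_leb hgn h0 s.1.2)]
      gcongr
      exact le_abs_self _
    intro s t
    rcases lt_trichotomy (s : ℝ) t with h | h | h
    · rw [dist_comm, abs_sub_comm]; exact aux s t h
    · rw [h]; simp
    · exact aux t s h
  have hu : UniformContinuous fun s : S => j (ρ s) := by
    rw [Metric.uniformContinuous_iff]
    intro ε hε
    obtain ⟨δ, hδ, h⟩ := Metric.uniformContinuousOn_iff.1 hPu ((ε / 4) ^ 2) (by positivity)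
    refine ⟨δ, hδ, fun {s t} hst => ?_⟩
    have h1 := h s s.1.2 t t.1.2 hst
    have h2 : √|P s - P t| < ε / 4 := by
      rw [Real.sqrt_lt' (by positivity)]
      exact h1
    linarith [hdist s t]
  have hcont := uniformContinuous_uniformly_extend (isUniformInducing_val S) hS.denseRange_val hu
  refine ⟨⟨_, hcont.continuous⟩, ?_⟩
  filter_upwards [hpae] with t h1 ht
  exact uniformly_extend_of_ind (isUniformInducing_val S) hS.denseRange_val hu ⟨⟨t, ht⟩, h1⟩

variable {r : C(Icc 0 T, H)}

/-- The energy identity for the continuous representative. -/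
theorem norm_sq_rep_eq (hT : 0 < T) (hρm : StronglyMeasurable ρ)
    (hgm : StronglyMeasurable g) (hρ : MemLp ρ 2 (leb 0 T)) (hg : MemLp g 2 (leb 0 T))
    {c : StrongDual ℝ E} (hc : ∀ᵐ t ∂leb 0 T, toDual j (ρ t) = c + ∫ s in (0 : ℝ)..t, g s)
    (hr : ∀ᵐ t ∂leb 0 T, ∀ ht : t ∈ Icc 0 T, r ⟨t, ht⟩ = j (ρ t)) (t : Icc 0 T) :
    ‖r t‖ ^ 2 = ‖r ⟨0, left_mem_Icc.2 hT.le⟩‖ ^ 2 + 2 * ∫ s in (0 : ℝ)..t, g s (ρ s) := by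
  obtain ⟨c₀, hc₀⟩ := exists_energy_identity hT hρm hgm hρ hg hc
  have hgρ := integrable_dual_apply hg hρ
  have h1 : EqOn (fun t => ‖IccExtend hT.le r t‖ ^ 2)
      (fun t => c₀ + 2 * ∫ s in (0 : ℝ)..t, g s (ρ s)) (Icc 0 T) := by
    refine Measure.eqOn_Icc_of_ae_eq volume hT.ne ?_
      ((r.continuous.Icc_extend').norm.pow 2).continuousOn
      (continuousOn_const.add (continuousOn_const.mul (continuousOn_primitive_leb hT.le hgρ)))
    rw [restrict_Ioo_eq_restrict_Icc.symm]
    filter_upwards [hc₀, hr, ae_restrict_mem measurableSet_Ioo] with t h2 h3 h4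
    rw [IccExtend_of_mem _ _ (Ioo_subset_Icc_self h4), h3, h2]
  have h2 := h1 t.2
  have h3 := h1 (left_mem_Icc.2 hT.le)
  simp only [IccExtend_of_mem _ _ t.2] at h2
  simp only [IccExtend_of_mem _ _ (left_mem_Icc.2 hT.le), intervalIntegral.integral_same, mul_zero,
    add_zero] at h3
  rw [h3, h2]

/-- The values of the continuous representative, seen in `E*`. -/
theorem inner_rep_eq (hT : 0 < T) (hg : MemLp g 2 (leb 0 T))
    {c : StrongDual ℝ E} (hc : ∀ᵐ t ∂leb 0 T, toDual j (ρ t) = c + ∫ s in (0 : ℝ)..t, g s)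
    (hr : ∀ᵐ t ∂leb 0 T, ∀ ht : t ∈ Icc 0 T, r ⟨t, ht⟩ = j (ρ t)) (t : Icc 0 T) (v : E) :
    inner ℝ (r t) (j v) = (c + ∫ s in (0 : ℝ)..t, g s) v := by
  have h1 : EqOn (fun t => inner ℝ (IccExtend hT.le r t) (j v))
      (fun t => (c + ∫ s in (0 : ℝ)..t, g s) v) (Icc 0 T) := by
    refine Measure.eqOn_Icc_of_ae_eq volume hT.ne ?_
      ((r.continuous.Icc_extend').inner continuous_const).continuousOn
      ((continuousOn_const.add (continuousOn_primitive_leb hT.le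
        (MemLp.integrable_leb hg))).clm_apply continuousOn_const)
    rw [restrict_Ioo_eq_restrict_Icc.symm]
    filter_upwards [hc, hr, ae_restrict_mem measurableSet_Ioo] with t h2 h3 h4
    rw [IccExtend_of_mem _ _ (Ioo_subset_Icc_self h4), h3, ← h2, toDual_apply]
  have h2 := h1 t.2
  simpa only [IccExtend_of_mem _ _ t.2] using h2

end Representative

/-! ### Time-dependent bilinear forms -/

section TimeForm

open Filter Topology

variable {V : Type*} [NormedAddCommGroup V] [InnerProductSpace ℝ V] [SecondCountableTopology V]
  {B : ℝ → V →L[ℝ] V →L[ℝ] ℝ} {K T : ℝ}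

theorem aestronglyMeasurable_timeForm (hBm : ∀ v w, StronglyMeasurable fun t => B t v w)
    {μ : Measure ℝ} {f g : ℝ → V} (hf : AEStronglyMeasurable f μ) (hg : AEStronglyMeasurable g μ) :
    AEStronglyMeasurable (fun t => B t (f t) (g t)) μ := by
  borelize V
  have hu := stronglyMeasurable_uncurry_of_continuous_of_stronglyMeasurable
    (u := fun (p : V × V) t => B t p.1 p.2) (fun t => by fun_prop) (fun p => hBm p.1 p.2)
  have hm : Measurable fun t => ((hf.mk f t, hg.mk g t), t) :=
    (hf.stronglyMeasurable_mk.measurable.prodMk hg.stronglyMeasurable_mk.measurable).prodMk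
      measurable_id
  refine ⟨_, hu.comp_measurable hm, ?_⟩
  filter_upwards [hf.ae_eq_mk, hg.ae_eq_mk] with t h1 h2
  simp [Function.comp, ← h1, ← h2]

theorem integrable_timeForm (hBm : ∀ v w, StronglyMeasurable fun t => B t v w)
    (hBK : ∀ t, ‖B t‖ ≤ K) {f g : ℝ → V} (hf : MemLp f 2 (leb 0 T)) (hg : MemLp g 2 (leb 0 T)) :
    Integrable (fun t => B t (f t) (g t)) (leb 0 T) := by
  refine ((hf.norm.integrable_mul hg.norm).const_mul K).mono'
    (aestronglyMeasurable_timeForm hBm hf.aestronglyMeasurable hg.aestronglyMeasurable)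
    (Eventually.of_forall fun t => ?_)
  refine ((B t).le_opNorm₂ _ _).trans ?_
  rw [mul_assoc]
  exact mul_le_mul_of_nonneg_right (hBK t) (by positivity)

theorem integral_norm_mul_norm_le {E F : Type*} [NormedAddCommGroup E] [NormedAddCommGroup F]
    (f : L2Time T E) (g : L2Time T F) : ∫ t in Ioo 0 T, ‖f t‖ * ‖g t‖ ≤ ‖f‖ * ‖g‖ := by
  have h := lintegral_enorm_mul_enorm_le (Lp.aestronglyMeasurable f) (Lp.aestronglyMeasurable g)
  have hm : AEStronglyMeasurable (fun t => ‖f t‖ * ‖g t‖) (leb 0 T) :=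
    (Lp.aestronglyMeasurable f).norm.mul (Lp.aestronglyMeasurable g).norm
  rw [integral_eq_lintegral_of_nonneg_ae (Eventually.of_forall fun t => by positivity) hm, Lp.norm_def,
    Lp.norm_def, ← ENNReal.toReal_mul]
  refine ENNReal.toReal_mono (ENNReal.mul_ne_top (Lp.eLpNorm_ne_top f) (Lp.eLpNorm_ne_top g)) ?_
  refine le_trans (le_of_eq ?_) h
  refine lintegral_congr fun t => ?_
  rw [ENNReal.ofReal_mul (norm_nonneg _), ofReal_norm, ofReal_norm]

/-- A measurable, uniformly bounded family `B(t)` of bilinear forms on `V` defines the bounded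
bilinear form `(u,w) ↦ ∫₀ᵀ B(t)(u(t),w(t)) dt` on `L²(0,T;V)`. -/
theorem exists_integral_timeForm (T : ℝ) (hBm : ∀ v w, StronglyMeasurable fun t => B t v w)
    (hBK : ∀ t, ‖B t‖ ≤ K) :
    ∃ β : L2Time T V →L[ℝ] L2Time T V →L[ℝ] ℝ,
      ∀ u w, β u w = ∫ t in Ioo 0 T, B t (u t) (w t) := by
  have hi : ∀ u w : L2Time T V, Integrable (fun t => B t (u t) (w t)) (leb 0 T) := fun u w =>
    integrable_timeForm hBm hBK (Lp.memLp u) (Lp.memLp w)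
  refine ⟨LinearMap.mkContinuous₂ (LinearMap.mk₂ ℝ
    (fun u w : L2Time T V => ∫ t in Ioo 0 T, B t (u t) (w t)) ?_ ?_ ?_ ?_) K ?_, fun u w => rfl⟩
  · intro u u' w
    rw [← integral_add (hi u w) (hi u' w)]
    refine integral_congr_ae ((Lp.coeFn_add u u').mono fun t ht => ?_)
    simp only [ht, Pi.add_apply, map_add, add_apply]
  · intro c u w
    rw [smul_eq_mul, ← integral_const_mul]
    refine integral_congr_ae ((Lp.coeFn_smul c u).mono fun t ht => ?_)
    simp only [ht, Pi.smul_apply, map_smul, smul_apply, smul_eq_mul]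
  · intro u w w'
    rw [← integral_add (hi u w) (hi u w')]
    refine integral_congr_ae ((Lp.coeFn_add w w').mono fun t ht => ?_)
    simp only [ht, Pi.add_apply, map_add]
  · intro c u w
    rw [smul_eq_mul, ← integral_const_mul]
    refine integral_congr_ae ((Lp.coeFn_smul c w).mono fun t ht => ?_)
    simp only [ht, Pi.smul_apply, map_smul, smul_eq_mul]
  · intro u w
    have hK : 0 ≤ K := (norm_nonneg (B 0)).trans (hBK 0)
    rw [LinearMap.mk₂_apply]
    refine (norm_integral_le_integral_norm _).trans ?_
    have h1 : ∫ t in Ioo 0 T, ‖B t (u t) (w t)‖ ≤ ∫ t in Ioo 0 T, K * (‖u t‖ * ‖w t‖) := by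
      refine integral_mono (hi u w).norm
        (((Lp.memLp u).norm.integrable_mul (Lp.memLp w).norm).const_mul K) fun t => ?_
      refine ((B t).le_opNorm₂ _ _).trans ?_
      rw [← mul_assoc]
      gcongr
      exact hBK t
    refine h1.trans ?_
    rw [integral_const_mul, mul_assoc]
    exact mul_le_mul_of_nonneg_left (integral_norm_mul_norm_le u w) hK

/-- If two functions with values in the dual of a separable space agree almost everywhere on each
vector, then almost everywhere they agree. -/
theorem ae_forall_apply_eq {α : Type*} [MeasurableSpace α] {μ : Measure α}
    {f g : α → StrongDual ℝ V} (h : ∀ v, ∀ᵐ t ∂μ, f t v = g t v) : ∀ᵐ t ∂μ, f t = g t := by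
  have h' : ∀ᵐ t ∂μ, ∀ n : ℕ, f t (TopologicalSpace.denseSeq V n)
      = g t (TopologicalSpace.denseSeq V n) := ae_all_iff.2 fun n => h _
  filter_upwards [h'] with t ht
  refine ContinuousLinearMap.coeFn_injective ?_
  refine (TopologicalSpace.denseRange_denseSeq V).equalizer (f t).continuous (g t).continuous ?_
  ext n
  exact ht n

/-- The operator in `L²(0,T;V)` representing `B` through the Riesz isomorphism of `L²(0,T;V)`; this
yields the measurability of `t ↦ B(t)(u(t),·)` as a function with values in the dual of `V`. -/
theorem exists_ae_inner_eq_timeForm [CompleteSpace V]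
    (hBm : ∀ v w, StronglyMeasurable fun t => B t v w) (hBK : ∀ t, ‖B t‖ ≤ K) (u : L2Time T V) :
    ∃ a : L2Time T V, ∀ᵐ t ∂leb 0 T, ∀ v, inner ℝ (a t) v = B t (u t) v := by
  obtain ⟨β, hβ⟩ := exists_integral_timeForm T hBm hBK
  refine ⟨(InnerProductSpace.toDual ℝ (L2Time T V)).symm (β u), ?_⟩
  set a := (InnerProductSpace.toDual ℝ (L2Time T V)).symm (β u) with ha
  have key : ∀ v, ∀ᵐ t ∂leb 0 T, innerSL ℝ (a t) v = B t (u t) v := by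
    intro v
    have i1 : Integrable (fun t => innerSL ℝ (a t) v) (leb 0 T) :=
      (Lp.memLp a).integrable (by norm_num) |>.inner_const v
    have i2 := integrable_timeForm hBm hBK (Lp.memLp u) (memLp_const (μ := leb 0 T) (p := 2) v)
    refine i1.ae_eq_of_forall_setIntegral_eq _ _ i2 fun s hs _ => ?_
    let w : L2Time T V := indicatorConstLp 2 hs (measure_ne_top _ s) v
    have hw : (w : ℝ → V) =ᵐ[leb 0 T] s.indicator fun _ => v := indicatorConstLp_coeFn
    have h1 : inner ℝ a w = β u w := InnerProductSpace.toDual_symm_apply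
    rw [L2.inner_def, hβ] at h1
    rw [← integral_indicator hs, ← integral_indicator hs]
    refine Eq.trans ?_ (h1.trans ?_)
    · refine integral_congr_ae (hw.mono fun t ht => ?_)
      dsimp only
      rw [ht]
      by_cases hts : t ∈ s <;> simp [hts]
    · refine integral_congr_ae (hw.mono fun t ht => ?_)
      dsimp only
      rw [ht]
      by_cases hts : t ∈ s <;> simp [hts]
  have := ae_forall_apply_eq (f := fun t => innerSL ℝ (a t)) (g := fun t => B t (u t)) key
  filter_upwards [this] with t ht v
  rw [← ht, innerSL_apply_apply]

end TimeForm

/-! ### Existence for the abstract evolution equation -/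

section Existence

open Filter Topology

/-- The bound `|L ψ| ≤ C ‖b ψ‖` makes `b ψ ↦ L ψ` a well-defined bounded functional on the range of
`b`, even if `b` is not injective; it extends by the Hahn-Banach theorem. -/
theorem exists_dual_forall_apply_eq_of_norm_le {Φ G : Type*} [AddCommGroup Φ] [Module ℝ Φ]
    [NormedAddCommGroup G] [NormedSpace ℝ G] (b : Φ →ₗ[ℝ] G) (L : Φ →ₗ[ℝ] ℝ) {C : ℝ}
    (h : ∀ ψ, |L ψ| ≤ C * ‖b ψ‖) : ∃ Λ : StrongDual ℝ G, ∀ ψ, Λ (b ψ) = L ψ := by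
  obtain ⟨s, hs⟩ := LinearMap.exists_rightInverse_of_surjective b.rangeRestrict
    (LinearMap.range_rangeRestrict b)
  have hs' : ∀ x : LinearMap.range b, b (s x) = x := fun x =>
    congrArg Subtype.val (LinearMap.congr_fun hs x)
  obtain ⟨Λ, hΛ, -⟩ := exists_extension_norm_eq (𝕜 := ℝ) (LinearMap.range b)
    ((L ∘ₗ s).mkContinuous C fun x => by
      refine (h (s x)).trans (le_of_eq ?_)
      rw [hs' x, Submodule.coe_norm])
  refine ⟨Λ, fun ψ => ?_⟩
  have h1 : Λ (b ψ) = L (s ⟨b ψ, LinearMap.mem_range_self b ψ⟩) := hΛ ⟨b ψ, _⟩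
  have h2 := h (ψ - s ⟨b ψ, LinearMap.mem_range_self b ψ⟩)
  rw [map_sub, map_sub, hs', sub_self, norm_zero, mul_zero] at h2
  rw [h1]
  exact (sub_eq_zero.1 (abs_eq_zero.1 (le_antisymm h2 (abs_nonneg _)))).symm

/-- Lions' projection lemma: if `|L ψ| ≤ C ‖b ψ‖` for a linear map `b` into the dual of a Hilbert
space `F`, then some `u ∈ F` solves `b ψ u = L ψ` for all `ψ`. It is the Riesz representative of a
Hahn-Banach extension of the functional `b ψ ↦ L ψ`. -/
theorem exists_forall_apply_eq_of_norm_le {Φ F : Type*} [AddCommGroup Φ] [Module ℝ Φ]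
    [NormedAddCommGroup F] [InnerProductSpace ℝ F] [CompleteSpace F] (b : Φ →ₗ[ℝ] StrongDual ℝ F)
    (L : Φ →ₗ[ℝ] ℝ) {C : ℝ} (h : ∀ ψ, |L ψ| ≤ C * ‖b ψ‖) : ∃ u, ∀ ψ, b ψ u = L ψ := by
  obtain ⟨Λ, hL⟩ := exists_dual_forall_apply_eq_of_norm_le b L h
  let D : F →L[ℝ] StrongDual ℝ F := toDualL (ContinuousLinearMap.id ℝ F)
  refine ⟨(InnerProductSpace.toDual ℝ F).symm (Λ.comp D), fun ψ => ?_⟩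
  have h3 : b ψ = D ((InnerProductSpace.toDual ℝ F).symm (b ψ)) := by
    ext x
    exact InnerProductSpace.toDual_symm_apply.symm
  have h4 : b ψ ((InnerProductSpace.toDual ℝ F).symm (Λ.comp D))
      = inner ℝ ((InnerProductSpace.toDual ℝ F).symm (Λ.comp D))
        ((InnerProductSpace.toDual ℝ F).symm (b ψ)) := by
    rw [real_inner_comm]
    exact InnerProductSpace.toDual_symm_apply.symm
  rw [h4, InnerProductSpace.toDual_symm_apply, ContinuousLinearMap.comp_apply, ← h3, hL]

/-- The space of test functions: the `C¹` functions `ψ : ℝ → V` with `ψ(T) = 0`. -/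
def timeTest (V : Type*) [NormedAddCommGroup V] [NormedSpace ℝ V] (T : ℝ) :
    Submodule ℝ (ℝ → V) where
  carrier := {ψ | ContDiff ℝ 1 ψ ∧ ψ T = 0}
  zero_mem' := ⟨contDiff_const, rfl⟩
  add_mem' h h' := ⟨h.1.add h'.1, by simp [h.2, h'.2]⟩
  smul_mem' c _ h := ⟨contDiff_const.smul h.1, by simp [h.2]⟩

theorem memLp_leb_of_continuous {E : Type*} [NormedAddCommGroup E] {f : ℝ → E} (hf : Continuous f)
    (T : ℝ) : MemLp f 2 (leb 0 T) := by
  obtain ⟨C, hC⟩ := isCompact_Icc.exists_bound_of_continuousOn (hf.continuousOn (s := Icc 0 T))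
  refine MemLp.of_bound hf.aestronglyMeasurable C ?_
  filter_upwards [ae_restrict_mem measurableSet_Ioo] with t ht
  exact hC t (Ioo_subset_Icc_self ht)

variable {V H : Type*} [NormedAddCommGroup V] [InnerProductSpace ℝ V]
  [NormedAddCommGroup H] [InnerProductSpace ℝ H] {j : V →L[ℝ] H}
  {B : ℝ → V →L[ℝ] V →L[ℝ] ℝ} {K α lam T : ℝ}

/-- Integration by parts with the weight `e^{2λt}`, for a function vanishing at time `T`. -/
theorem integral_exp_inner_deriv (hT : 0 ≤ T) (lam : ℝ) {ψ : ℝ → V} (hψ : ContDiff ℝ 1 ψ)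
    (hψT : ψ T = 0) :
    ∫ t in Ioo 0 T, Real.exp (2 * lam * t) * inner ℝ (j (ψ t)) (j (deriv ψ t))
      = -(‖j (ψ 0)‖ ^ 2 / 2) - ∫ t in Ioo 0 T, lam * (Real.exp (2 * lam * t) * ‖j (ψ t)‖ ^ 2) := by
  have hc : Continuous (deriv ψ) := hψ.continuous_deriv le_rfl
  have hc0 := hψ.continuous
  have hd : ∀ t, HasDerivAt (fun t => Real.exp (2 * lam * t) * ‖j (ψ t)‖ ^ 2 / 2)
      (Real.exp (2 * lam * t) * inner ℝ (j (ψ t)) (j (deriv ψ t))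
        + lam * (Real.exp (2 * lam * t) * ‖j (ψ t)‖ ^ 2)) t := by
    intro t
    have h1 : HasDerivAt (fun t => j (ψ t)) (j (deriv ψ t)) t :=
      j.hasFDerivAt.comp_hasDerivAt t (hψ.differentiable one_ne_zero t).hasDerivAt
    have h2 := h1.norm_sq
    have h3 : HasDerivAt (fun t => Real.exp (2 * lam * t)) (Real.exp (2 * lam * t) * (2 * lam)) t :=
      (((hasDerivAt_id t).const_mul (2 * lam)).exp).congr_deriv (by simp)
    refine ((h3.mul h2).div_const 2).congr_deriv ?_
    ring
  have c1 : Continuous fun t => Real.exp (2 * lam * t) * inner ℝ (j (ψ t)) (j (deriv ψ t)) := by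
    fun_prop
  have c2 : Continuous fun t => lam * (Real.exp (2 * lam * t) * ‖j (ψ t)‖ ^ 2) := by fun_prop
  have h := intervalIntegral.integral_eq_sub_of_hasDerivAt (a := 0) (b := T) (fun t _ => hd t)
    ((c1.add c2).intervalIntegrable _ _)
  rw [intervalIntegral.integral_add (c1.intervalIntegrable _ _) (c2.intervalIntegrable _ _), hψT,
    ← integral_Ioo_eq_intervalIntegral _ hT, ← integral_Ioo_eq_intervalIntegral _ hT] at h
  simp only [map_zero, norm_zero, mul_zero, Real.exp_zero, one_mul] at h
  linarith

/-- The coercivity estimate behind the existence proof: testing with `e^{2λt} ψ`. -/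
theorem coercive_exp_test [SecondCountableTopology V] (hT : 0 ≤ T)
    (hBm : ∀ v w, StronglyMeasurable fun t => B t v w)
    (hBK : ∀ t, ‖B t‖ ≤ K) (hlam : 0 ≤ lam) (hα : 0 ≤ α)
    (hB : ∀ t v, α * ‖v‖ ^ 2 ≤ B t v v + lam * ‖j v‖ ^ 2) {ψ : ℝ → V} (hψ : ContDiff ℝ 1 ψ)
    (hψT : ψ T = 0) :
    ‖j (ψ 0)‖ ^ 2 / 2 + α * ∫ t in Ioo 0 T, ‖ψ t‖ ^ 2
      ≤ (∫ t in Ioo 0 T, B t (Real.exp (2 * lam * t) • ψ t) (ψ t))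
        - ∫ t in Ioo 0 T, inner ℝ (j (Real.exp (2 * lam * t) • ψ t)) (j (deriv ψ t)) := by
  have hc0 := hψ.continuous
  have hi : ∀ {φ : ℝ → ℝ}, Continuous φ → Integrable φ (leb 0 T) := fun h =>
    MemLp.integrable_leb (memLp_leb_of_continuous h T)
  have i1 : Integrable (fun t => B t (Real.exp (2 * lam * t) • ψ t) (ψ t)) (leb 0 T) :=
    integrable_timeForm hBm hBK (memLp_leb_of_continuous (by fun_prop) T)
      (memLp_leb_of_continuous hc0 T)
  have i2 : Integrable (fun t => lam * (Real.exp (2 * lam * t) * ‖j (ψ t)‖ ^ 2)) (leb 0 T) :=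
    hi (by fun_prop)
  have e1 : ∫ t in Ioo 0 T, inner ℝ (j (Real.exp (2 * lam * t) • ψ t)) (j (deriv ψ t))
      = ∫ t in Ioo 0 T, Real.exp (2 * lam * t) * inner ℝ (j (ψ t)) (j (deriv ψ t)) := by
    simp only [map_smul, real_inner_smul_left]
  rw [e1, integral_exp_inner_deriv hT lam hψ hψT, ← integral_const_mul]
  have h1 : ∫ t in Ioo 0 T, α * ‖ψ t‖ ^ 2
      ≤ ∫ t in Ioo 0 T, (B t (Real.exp (2 * lam * t) • ψ t) (ψ t)
        + lam * (Real.exp (2 * lam * t) * ‖j (ψ t)‖ ^ 2)) := by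
    refine setIntegral_mono_on (hi (by fun_prop)) (i1.add i2) measurableSet_Ioo fun t ht => ?_
    have h2 : 1 ≤ Real.exp (2 * lam * t) := Real.one_le_exp (by have := ht.1; positivity)
    rw [map_smul, smul_apply, smul_eq_mul]
    calc α * ‖ψ t‖ ^ 2 ≤ Real.exp (2 * lam * t) * (α * ‖ψ t‖ ^ 2) :=
          le_mul_of_one_le_left (by positivity) h2
      _ ≤ Real.exp (2 * lam * t) * (B t (ψ t) (ψ t) + lam * ‖j (ψ t)‖ ^ 2) := by
          gcongr
          exact hB t (ψ t)
      _ = _ := by ring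
  rw [integral_add i1 i2] at h1
  linarith

theorem integral_norm_sq_eq (f : L2Time T V) : ∫ t in Ioo 0 T, ‖f t‖ ^ 2 = ‖f‖ ^ 2 := by
  rw [← real_inner_self_eq_norm_sq, L2.inner_def]
  simp only [real_inner_self_eq_norm_sq]

/-- The elementary estimates combining the bounds of the two sides of the variational equation. -/
theorem add_le_of_sq_le {m n β Q F R : ℝ} (hα : 0 < α) (hn : 0 ≤ n) (hβ : 0 ≤ β)
    (hQ : 0 ≤ Q) (hF : 0 ≤ F) (hR : 0 ≤ R) (h : m ^ 2 / 2 + α * n ^ 2 ≤ β * (Q * n)) :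
    F * n + R * m ≤ (F * (Q / α) + R * (Q * (1 + 2 / α))) * β := by
  have h1 : α * n ≤ β * Q := by
    rcases hn.eq_or_lt with h0 | h0
    · rw [← h0, mul_zero]; positivity
    · refine le_of_mul_le_mul_right ?_ h0
      nlinarith [sq_nonneg m]
  have h2 : n ≤ Q / α * β := by
    rw [div_mul_eq_mul_div, le_div_iff₀ hα]
    linarith
  have h3 : m ≤ Q * (1 + 2 / α) * β := by
    refine abs_le_of_sq_le_sq' ?_ (by positivity) |>.2
    have h4 : β * (Q * n) ≤ β * (Q * (Q / α * β)) := by gcongr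
    have h5 : m ^ 2 ≤ (Q * β) ^ 2 * (2 / α) := by
      have : (Q * β) ^ 2 * (2 / α) = 2 * (β * (Q * (Q / α * β))) := by ring
      rw [this]
      nlinarith [mul_nonneg hα.le (sq_nonneg n)]
    refine h5.trans ?_
    have h6 : 2 / α ≤ (1 + 2 / α) ^ 2 := by
      have : 0 ≤ 2 / α := by positivity
      nlinarith
    calc (Q * β) ^ 2 * (2 / α) ≤ (Q * β) ^ 2 * (1 + 2 / α) ^ 2 := by gcongr
      _ = _ := by ring
  calc F * n + R * m ≤ F * (Q / α * β) + R * (Q * (1 + 2 / α) * β) := by gcongr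
    _ = _ := by ring

/-- Existence of a solution in `L²(0,T;V)` of the variational equation, in which the time derivative
is put on the test functions and the initial datum appears on the right-hand side. -/
theorem exists_variational_solution [CompleteSpace V] [SecondCountableTopology V] (hT : 0 ≤ T)
    (hBm : ∀ v w, StronglyMeasurable fun t => B t v w)
    (hBK : ∀ t, ‖B t‖ ≤ K) (hlam : 0 ≤ lam) (hα : 0 < α)
    (hB : ∀ t v, α * ‖v‖ ^ 2 ≤ B t v v + lam * ‖j v‖ ^ 2) (f : L2Time T (StrongDual ℝ V)) (ρ₀ : H) :
    ∃ u : L2Time T V, ∀ ψ : ℝ → V, ContDiff ℝ 1 ψ → ψ T = 0 →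
      (∫ t in Ioo 0 T, B t (u t) (ψ t)) - ∫ t in Ioo 0 T, inner ℝ (j (u t)) (j (deriv ψ t))
        = (∫ t in Ioo 0 T, f t (ψ t)) + inner ℝ ρ₀ (j (ψ 0)) := by
  obtain ⟨β, hβ⟩ := exists_integral_timeForm T hBm hBK
  obtain ⟨βj, hβj⟩ := exists_integral_timeForm T (B := fun _ => toDualL j)
    (fun v w => stronglyMeasurable_const) (fun _ => le_rfl)
  have hc : ∀ ψ : timeTest V T, Continuous (ψ : ℝ → V) := fun ψ => ψ.2.1.continuous
  have hc' : ∀ ψ : timeTest V T, Continuous (deriv (ψ : ℝ → V)) := fun ψ =>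
    ψ.2.1.continuous_deriv le_rfl
  have hd : ∀ (ψ : timeTest V T) t, DifferentiableAt ℝ (ψ : ℝ → V) t := fun ψ t =>
    ψ.2.1.differentiable one_ne_zero t
  let ι₀ : timeTest V T →ₗ[ℝ] L2Time T V :=
    { toFun := fun ψ => (memLp_leb_of_continuous (hc ψ) T).toLp _
      map_add' := fun ψ ψ' => MemLp.toLp_add _ _
      map_smul' := fun c ψ => MemLp.toLp_const_smul _ _ }
  let ι₁ : timeTest V T →ₗ[ℝ] L2Time T V :=
    { toFun := fun ψ => (memLp_leb_of_continuous (hc' ψ) T).toLp _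
      map_add' := fun ψ ψ' => by
        rw [← MemLp.toLp_add]
        congr 1
        ext t
        exact deriv_add (hd ψ t) (hd ψ' t)
      map_smul' := fun c ψ => by
        rw [RingHom.id_apply, ← MemLp.toLp_const_smul]
        congr 1
        ext t
        exact deriv_const_smul c (hd ψ t) }
  have hι₀ : ∀ ψ, (ι₀ ψ : ℝ → V) =ᵐ[leb 0 T] ψ :=
    fun ψ => MemLp.coeFn_toLp (memLp_leb_of_continuous (hc ψ) T)
  have hι₁ : ∀ ψ : timeTest V T, (ι₁ ψ : ℝ → V) =ᵐ[leb 0 T] deriv (ψ : ℝ → V) :=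
    fun ψ => MemLp.coeFn_toLp (memLp_leb_of_continuous (hc' ψ) T)
  let b : timeTest V T →ₗ[ℝ] StrongDual ℝ (L2Time T V) :=
    (β.flip : L2Time T V →ₗ[ℝ] StrongDual ℝ (L2Time T V)) ∘ₗ ι₀
      - (βj.flip : L2Time T V →ₗ[ℝ] StrongDual ℝ (L2Time T V)) ∘ₗ ι₁
  have hb : ∀ (ψ : timeTest V T) (u : L2Time T V), b ψ u = (∫ t in Ioo 0 T, B t (u t) ((ψ : ℝ → V) t))
      - ∫ t in Ioo 0 T, inner ℝ (j (u t)) (j (deriv (ψ : ℝ → V) t)) := by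
    intro ψ u
    have h1 : b ψ u = β u (ι₀ ψ) - βj u (ι₁ ψ) := rfl
    rw [h1, hβ, hβj]
    congr 1
    · exact integral_congr_ae ((hι₀ ψ).mono fun t ht => by dsimp only; rw [ht])
    · exact integral_congr_ae ((hι₁ ψ).mono fun t ht => by dsimp only; rw [ht]; rfl)
  have hfi : ∀ ψ : timeTest V T, Integrable (fun t => f t ((ψ : ℝ → V) t)) (leb 0 T) := fun ψ =>
    integrable_dual_apply (Lp.memLp f) (memLp_leb_of_continuous (hc ψ) T)
  let L : timeTest V T →ₗ[ℝ] ℝ :=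
    { toFun := fun ψ => (∫ t in Ioo 0 T, f t ((ψ : ℝ → V) t)) + inner ℝ ρ₀ (j ((ψ : ℝ → V) 0))
      map_add' := fun ψ ψ' => by
        simp only [Submodule.coe_add, Pi.add_apply, map_add, inner_add_right]
        rw [integral_add (hfi ψ) (hfi ψ')]
        ring
      map_smul' := fun c ψ => by
        simp only [Submodule.coe_smul, Pi.smul_apply, map_smul, inner_smul_right, smul_eq_mul,
          RingHom.id_apply]
        rw [integral_const_mul]
        ring }
  -- `Q` bounds the weight `e^{2λt}` on `(0,T)`
  set Q := Real.exp (2 * lam * T) with hQ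
  obtain ⟨u, hu⟩ := exists_forall_apply_eq_of_norm_le b L
    (C := ‖f‖ * (Q / α) + ‖ρ₀‖ * (Q * (1 + 2 / α))) fun ψ => by
      have hL : |L ψ| ≤ ‖f‖ * ‖ι₀ ψ‖ + ‖ρ₀‖ * ‖j ((ψ : ℝ → V) 0)‖ := by
        refine (abs_add_le _ _).trans (add_le_add ?_ (abs_real_inner_le_norm _ _))
        refine le_trans ?_ (integral_norm_mul_norm_le f (ι₀ ψ))
        rw [← Real.norm_eq_abs]
        refine (norm_integral_le_integral_norm _).trans ?_
        refine integral_mono_ae (hfi ψ).norm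
          (integrable_norm_dual_mul_norm (Lp.memLp f) (Lp.memLp (ι₀ ψ))) ?_
        filter_upwards [hι₀ ψ] with t ht
        rw [ht]
        exact (f t).le_opNorm _
      refine hL.trans (add_le_of_sq_le hα (norm_nonneg _) (norm_nonneg _) (Real.exp_nonneg _)
        (norm_nonneg _) (norm_nonneg _) ?_)
      have hec : Continuous fun t => Real.exp (2 * lam * t) • (ψ : ℝ → V) t := by
        have := hc ψ
        fun_prop
      -- the norm of `b ψ` is estimated from below by its value at `x = e^{2λt} ψ`
      set x : L2Time T V := (memLp_leb_of_continuous hec T).toLp _ with hx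
      have hxe : (x : ℝ → V) =ᵐ[leb 0 T] fun t => Real.exp (2 * lam * t) • (ψ : ℝ → V) t :=
        MemLp.coeFn_toLp (memLp_leb_of_continuous hec T)
      have hxn : ‖x‖ ≤ Q * ‖ι₀ ψ‖ := by
        refine Lp.norm_le_mul_norm_of_ae_le_mul ?_
        filter_upwards [hxe, hι₀ ψ, ae_restrict_mem measurableSet_Ioo] with t h1 h2 h3
        rw [h1, h2, norm_smul, Real.norm_of_nonneg (Real.exp_nonneg _)]
        refine mul_le_mul_of_nonneg_right (Real.exp_le_exp.2 ?_) (norm_nonneg _)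
        exact mul_le_mul_of_nonneg_left h3.2.le (by positivity)
      have h1 := coercive_exp_test hT hBm hBK hlam hα.le hB ψ.2.1 ψ.2.2
      have h2 : b ψ x = (∫ t in Ioo 0 T, B t (Real.exp (2 * lam * t) • (ψ : ℝ → V) t) ((ψ : ℝ → V) t))
          - ∫ t in Ioo 0 T, inner ℝ (j (Real.exp (2 * lam * t) • (ψ : ℝ → V) t))
            (j (deriv (ψ : ℝ → V) t)) := by
        rw [hb]
        congr 1
        · exact integral_congr_ae (hxe.mono fun t ht => by dsimp only; rw [ht])
        · exact integral_congr_ae (hxe.mono fun t ht => by dsimp only; rw [ht])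
      have h3 : ∫ t in Ioo 0 T, ‖(ψ : ℝ → V) t‖ ^ 2 = ‖ι₀ ψ‖ ^ 2 := by
        rw [← integral_norm_sq_eq]
        exact integral_congr_ae ((hι₀ ψ).mono fun t ht => by dsimp only; rw [ht])
      rw [← h2, h3] at h1
      refine h1.trans ((le_abs_self _).trans (((b ψ).le_opNorm x).trans ?_))
      exact mul_le_mul_of_nonneg_left hxn (norm_nonneg _)
  refine ⟨u, fun ψ hψ hψT => ?_⟩
  rw [← hb ⟨ψ, hψ, hψT⟩ u]
  exact hu ⟨ψ, hψ, hψT⟩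

end Existence

/-! ### Well-posedness of the abstract evolution equation -/

section Evolution

open Filter Topology

variable {V H : Type*} [NormedAddCommGroup V] [InnerProductSpace ℝ V]
  [NormedAddCommGroup H] [InnerProductSpace ℝ H] {j : V →L[ℝ] H}
  {B : ℝ → V →L[ℝ] V →L[ℝ] ℝ} {K α lam T : ℝ}

/-- Solutions `ρ ∈ W(0,T)` of `ρ' + B(t) ρ = f` in `V*` for almost every `t`, whose representative
in `C([0,T];H)` takes the value `ρ₀` at `t = 0`. -/
structure IsEvolutionSolution (hT : 0 < T) (B : ℝ → V →L[ℝ] V →L[ℝ] ℝ)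
    (f : L2Time T (StrongDual ℝ V)) (ρ₀ : H) (ρ : WSub j T) : Prop where
  equation : ∀ᵐ t ∂leb 0 T, ρ.1.snd t + B t (ρ.1.fst t) = f t
  initial : ∃ r : C(Icc 0 T, H), (∀ᵐ t ∂leb 0 T, ∀ ht : t ∈ Icc 0 T, r ⟨t, ht⟩ = j (ρ.1.fst t)) ∧
    r ⟨0, left_mem_Icc.2 hT.le⟩ = ρ₀

theorem WSub.exists_ae_eq_primitive (hT : 0 < T) (ρ : WSub j T) :
    ∃ c : StrongDual ℝ V, ∀ᵐ t ∂leb 0 T,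
      toDual j (ρ.1.fst t) = c + ∫ s in (0 : ℝ)..t, ρ.1.snd s :=
  IsWeakTimeDeriv.exists_ae_eq_primitive hT
    (MemLp.integrable_leb ((toDualL j).comp_memLp' (Lp.memLp ρ.1.fst)))
    (MemLp.integrable_leb (Lp.memLp ρ.1.snd)) ρ.2

theorem integrable_testFunction_mul {k : ℝ → ℝ} (hk : Integrable k (leb 0 T))
    {φ : ℝ → ℝ} (h1 : Continuous φ) (h2 : HasCompactSupport φ) :
    Integrable (fun t => k t * φ t) (leb 0 T) := by
  obtain ⟨C, hC⟩ := h1.bounded_above_of_compact_support h2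
  exact hk.mul_bdd h1.aestronglyMeasurable (Eventually.of_forall hC)

theorem WSub.integral_inner_mul_deriv (ρ : WSub j T) (φ : V) (θ : 𝓓(interval 0 T, ℝ)) :
    ∫ t in Ioo 0 T, inner ℝ (j (ρ.1.fst t)) (j φ) * deriv θ t
      = -∫ t in Ioo 0 T, ρ.1.snd t φ * θ t := by
  have i1 := integrable_smul_of_memLp (testFunction_deriv_memLp θ 2 (leb 0 T))
    ((toDualL j).comp_memLp' (Lp.memLp ρ.1.fst))
  have i2 := integrable_smul_of_memLp (testFunction_memLp θ 2 (leb 0 T)) (Lp.memLp ρ.1.snd)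
  have h := congrArg (fun l : StrongDual ℝ V => l φ) (ρ.2 θ)
  have e1 := ContinuousLinearMap.integral_apply i1 φ
  have e2 := ContinuousLinearMap.integral_apply i2 φ
  refine Eq.trans ?_ ((e1.symm.trans h).trans ((neg_apply _ _).trans (congrArg Neg.neg (e2.trans ?_))))
  · exact integral_congr_ae (Eventually.of_forall fun t => mul_comm _ _)
  · exact integral_congr_ae (Eventually.of_forall fun t => mul_comm _ _)

theorem integrable_timeForm_const [SecondCountableTopology V]
    (hBm : ∀ v w, StronglyMeasurable fun t => B t v w) (hBK : ∀ t, ‖B t‖ ≤ K)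
    (u : L2Time T V) (φ : V) : Integrable (fun t => B t (u t) φ) (leb 0 T) :=
  integrable_timeForm hBm hBK (Lp.memLp u) (memLp_const φ)

theorem integrable_dual_apply_const (f : L2Time T (StrongDual ℝ V)) (φ : V) :
    Integrable (fun t => f t φ) (leb 0 T) :=
  (MemLp.integrable_leb (Lp.memLp f)).apply_continuousLinearMap φ

/-- For `ρ ∈ W(0,T)`, the equation tested against `V` in the sense of distributions on `(0,T)`
holds if and only if it holds in `V*` for almost every `t`. -/
theorem distributional_iff_ae [SecondCountableTopology V]
    (hBm : ∀ v w, StronglyMeasurable fun t => B t v w) (hBK : ∀ t, ‖B t‖ ≤ K)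
    (f : L2Time T (StrongDual ℝ V)) (ρ : WSub j T) :
    (∀ (φ : V) (θ : 𝓓(interval 0 T, ℝ)),
      -(∫ t in Ioo 0 T, inner ℝ (j (ρ.1.fst t)) (j φ) * deriv θ t)
        + ∫ t in Ioo 0 T, B t (ρ.1.fst t) φ * θ t = ∫ t in Ioo 0 T, f t φ * θ t) ↔
    ∀ᵐ t ∂leb 0 T, ρ.1.snd t + B t (ρ.1.fst t) = f t := by
  have key : ∀ (φ : V) (θ : ℝ → ℝ), Continuous θ → HasCompactSupport θ →
      ∫ t in Ioo 0 T, θ t • (ρ.1.snd t φ + B t (ρ.1.fst t) φ - f t φ)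
        = (∫ t in Ioo 0 T, ρ.1.snd t φ * θ t) + (∫ t in Ioo 0 T, B t (ρ.1.fst t) φ * θ t)
          - ∫ t in Ioo 0 T, f t φ * θ t := by
    intro φ θ h1 h2
    have i1 := integrable_testFunction_mul (integrable_dual_apply_const ρ.1.snd φ) h1 h2
    have i2 := integrable_testFunction_mul (integrable_timeForm_const hBm hBK ρ.1.fst φ) h1 h2
    have i3 := integrable_testFunction_mul (integrable_dual_apply_const f φ) h1 h2
    have i4 : Integrable (fun t => ρ.1.snd t φ * θ t + B t (ρ.1.fst t) φ * θ t) (leb 0 T) :=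
      i1.add i2
    rw [← integral_add i1 i2, ← integral_sub i4 i3]
    refine integral_congr_ae (Eventually.of_forall fun t => ?_)
    simp only [smul_eq_mul]
    ring
  constructor
  · intro h
    refine ae_forall_apply_eq (f := fun t => ρ.1.snd t + B t (ρ.1.fst t)) fun φ => ?_
    have hi : Integrable (fun t => ρ.1.snd t φ + B t (ρ.1.fst t) φ - f t φ) (leb 0 T) :=
      ((integrable_dual_apply_const ρ.1.snd φ).add
        (integrable_timeForm_const hBm hBK ρ.1.fst φ)).sub (integrable_dual_apply_const f φ)
    have h0 : ∀ᵐ t, t ∈ Ioo 0 T → ρ.1.snd t φ + B t (ρ.1.fst t) φ - f t φ = 0 := by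
      refine isOpen_Ioo.ae_eq_zero_of_integral_contDiff_smul_eq_zero
        (IntegrableOn.locallyIntegrableOn hi) fun θ hθ hθc hθs => ?_
      have h1 := h φ ⟨θ, hθ, hθc, hθs⟩
      rw [WSub.integral_inner_mul_deriv, neg_neg] at h1
      rw [← setIntegral_eq_integral_of_forall_compl_eq_zero (s := Ioo 0 T), key φ θ hθ.continuous hθc]
      · exact sub_eq_zero.2 h1
      · intro t ht
        rw [image_eq_zero_of_notMem_tsupport fun h => ht (hθs h), zero_smul]
    rw [← ae_restrict_iff' measurableSet_Ioo] at h0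
    exact h0.mono fun t ht => sub_eq_zero.1 ht
  · intro h φ θ
    rw [WSub.integral_inner_mul_deriv, neg_neg, ← sub_eq_zero,
      ← key φ θ θ.continuous θ.hasCompactSupport]
    refine integral_eq_zero_of_ae (h.mono fun t ht => ?_)
    dsimp only
    rw [← ht, add_apply, sub_self, smul_zero]
    rfl

/-- Existence for the abstract evolution equation. The density of the range of `j` serves to
identify the initial value in `H` from its products with elements of `V`. -/
theorem exists_isEvolutionSolution [CompleteSpace V] [SecondCountableTopology V] [CompleteSpace H]
    (hT : 0 < T) (hj : DenseRange j) (hBm : ∀ v w, StronglyMeasurable fun t => B t v w)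
    (hBK : ∀ t, ‖B t‖ ≤ K) (hlam : 0 ≤ lam) (hα : 0 < α)
    (hB : ∀ t v, α * ‖v‖ ^ 2 ≤ B t v v + lam * ‖j v‖ ^ 2) (f : L2Time T (StrongDual ℝ V)) (ρ₀ : H) :
    ∃ ρ : WSub j T, IsEvolutionSolution hT B f ρ₀ ρ := by
  obtain ⟨u, hu⟩ := exists_variational_solution hT.le hBm hBK hlam hα hB f ρ₀
  obtain ⟨a, ha⟩ := exists_ae_inner_eq_timeForm hBm hBK u
  let g : L2Time T (StrongDual ℝ V) := f - (toDualL (ContinuousLinearMap.id ℝ V)).compLp a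
  have hg : ∀ᵐ t ∂leb 0 T, g t + B t (u t) = f t := by
    filter_upwards [Lp.coeFn_sub f ((toDualL (ContinuousLinearMap.id ℝ V)).compLp a),
      (toDualL (ContinuousLinearMap.id ℝ V)).coeFn_compLp a, ha] with t h1 h2 h3
    ext v
    rw [h1, Pi.sub_apply, h2, add_apply, sub_apply, ← h3]
    exact sub_add_cancel _ _
  -- the variational equation for products `θ(t) φ`
  have hprod : ∀ (θ : ℝ → ℝ) (φ : V), ContDiff ℝ 1 θ → θ T = 0 →
      ∫ t in Ioo 0 T, inner ℝ (j (u t)) (j φ) * deriv θ t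
        = -(∫ t in Ioo 0 T, g t φ * θ t) - θ 0 * inner ℝ ρ₀ (j φ) := by
    intro θ φ hθ hθT
    have h1 := hu (fun t => θ t • φ) (hθ.smul contDiff_const) (by simp [hθT])
    have hm : ∀ {k : ℝ → ℝ}, Integrable k (leb 0 T) → Integrable (fun t => k t * θ t) (leb 0 T) := by
      intro k hk
      obtain ⟨C, hC⟩ := isCompact_Icc.exists_bound_of_continuousOn
        (hθ.continuous.continuousOn (s := Icc 0 T))
      refine hk.mul_bdd hθ.continuous.aestronglyMeasurable (c := C) ?_
      filter_upwards [ae_restrict_mem measurableSet_Ioo] with t ht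
      exact hC t (Ioo_subset_Icc_self ht)
    have e1 : ∫ t in Ioo 0 T, inner ℝ (j (u t)) (j (deriv (fun t => θ t • φ) t))
        = ∫ t in Ioo 0 T, inner ℝ (j (u t)) (j φ) * deriv θ t := by
      refine integral_congr_ae (Eventually.of_forall fun t => ?_)
      dsimp only
      rw [deriv_smul_const (hθ.differentiable one_ne_zero t), map_smul, real_inner_smul_right,
        mul_comm]
    have e2 : ∫ t in Ioo 0 T, g t φ * θ t
        = (∫ t in Ioo 0 T, f t (θ t • φ)) - ∫ t in Ioo 0 T, B t (u t) (θ t • φ) := by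
      have i1 : Integrable (fun t => f t (θ t • φ)) (leb 0 T) := by
        simpa only [map_smul, smul_eq_mul, mul_comm] using hm (integrable_dual_apply_const f φ)
      have i2 : Integrable (fun t => B t (u t) (θ t • φ)) (leb 0 T) := by
        simpa only [map_smul, smul_eq_mul, mul_comm] using
          hm (integrable_timeForm_const hBm hBK u φ)
      rw [← integral_sub i1 i2]
      refine integral_congr_ae (hg.mono fun t ht => ?_)
      dsimp only
      rw [← ht, map_smul, map_smul, add_apply, smul_eq_mul, smul_eq_mul]
      ring
    rw [e1, map_smul, real_inner_smul_right] at h1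
    rw [e2]
    linarith
  have hW : IsWeakTimeDeriv T (fun t => toDual j (u t)) g := by
    intro θ
    have i1 := integrable_smul_of_memLp (testFunction_deriv_memLp θ 2 (leb 0 T))
      ((toDualL j).comp_memLp' (Lp.memLp u))
    have i2 := integrable_smul_of_memLp (testFunction_memLp θ 2 (leb 0 T)) (Lp.memLp g)
    have hv : ∀ s ∉ Ioo 0 T, θ s = 0 := fun s hs =>
      image_eq_zero_of_notMem_tsupport fun h => hs (θ.tsupport_subset h)
    ext φ
    have h1 := hprod θ φ (θ.contDiff.of_le (by simp)) (hv T fun h => lt_irrefl _ h.2)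
    rw [hv 0 fun h => lt_irrefl _ h.1, zero_mul, sub_zero] at h1
    refine (ContinuousLinearMap.integral_apply i1 φ).trans (Eq.trans ?_ (h1.trans ?_))
    · exact integral_congr_ae (Eventually.of_forall fun t => mul_comm _ _)
    · refine Eq.trans (congrArg Neg.neg ?_) (neg_apply _ _).symm
      refine Eq.trans ?_ (ContinuousLinearMap.integral_apply i2 φ).symm
      exact integral_congr_ae (Eventually.of_forall fun t => mul_comm _ _)
  let ρ : WSub j T := ⟨WithLp.toLp 2 (u, g), hW⟩
  obtain ⟨c, hc⟩ := WSub.exists_ae_eq_primitive hT ρ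
  obtain ⟨r, hr⟩ := exists_continuousMap_ae_eq hT (Lp.stronglyMeasurable u)
    (Lp.stronglyMeasurable g) (Lp.memLp u) (Lp.memLp g) hc
  refine ⟨ρ, hg, r, hr, ?_⟩
  have h0 := inner_rep_eq hT (Lp.memLp g) hc hr ⟨0, left_mem_Icc.2 hT.le⟩
  -- the initial datum is recovered from the weight `θ(t) = T - t`
  have hcρ : ∀ φ, c φ = inner ℝ ρ₀ (j φ) := by
    intro φ
    have hθ : ContDiff ℝ 1 fun t : ℝ => T - t := contDiff_const.sub contDiff_id
    have h1 := hprod (fun t => T - t) φ hθ (sub_self T)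
    have hgφ := integrable_dual_apply_const g φ
    have h2 := integral_deriv_smul_primitive hθ hgφ
    have hd : ∀ t, deriv (fun t : ℝ => T - t) t = -1 := fun t => by simp
    have e1 : ∫ t in Ioo 0 T, inner ℝ (j (u t)) (j φ) * deriv (fun t : ℝ => T - t) t
        = ∫ t in Ioo 0 T, (-c φ + deriv (fun t : ℝ => T - t) t • ∫ s in (0 : ℝ)..t, g s φ) := by
      refine integral_congr_ae ?_
      filter_upwards [hc, ae_restrict_mem measurableSet_Ioo] with t h3 h4
      have h5 : inner ℝ (j (u t)) (j φ) = c φ + ∫ s in (0 : ℝ)..t, g s φ := by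
        have h6 : inner ℝ (j (u t)) (j φ) = (c + ∫ s in (0 : ℝ)..t, g s) φ :=
          congrArg (fun l : StrongDual ℝ V => l φ) h3
        rw [h6, add_apply, ContinuousLinearMap.intervalIntegral_apply]
        exact intervalIntegrable_of_leb (MemLp.integrable_leb (Lp.memLp g))
          (left_mem_Icc.2 hT.le) (Ioo_subset_Icc_self h4)
      rw [h5, hd, smul_eq_mul]
      ring
    have i3 : Integrable (fun t => deriv (fun t : ℝ => T - t) t • ∫ s in (0 : ℝ)..t, g s φ)
        (leb 0 T) := by
      simp only [hd]
      exact (((continuousOn_primitive_leb hT.le hgφ).integrableOn_Icc).mono_set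
        Ioo_subset_Icc_self).smul (-1 : ℝ)
    rw [e1, integral_add (integrable_const _) i3, h2] at h1
    have e2 : ∫ s in Ioo 0 T, (T - T - (T - s)) • g s φ = -∫ t in Ioo 0 T, g t φ * (T - t) := by
      rw [← integral_neg]
      refine integral_congr_ae (Eventually.of_forall fun t => ?_)
      simp only [smul_eq_mul]
      ring
    rw [e2, integral_const] at h1
    simp only [measureReal_restrict_apply_univ, Real.volume_real_Ioo_of_le hT.le, smul_eq_mul,
      sub_zero] at h1
    have h7 : T * c φ = T * inner ℝ ρ₀ (j φ) := by linarith
    exact mul_left_cancel₀ hT.ne' h7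
  refine hj.eq_of_inner_left ℝ fun φ => ?_
  rw [← hcρ, h0, intervalIntegral.integral_same, add_zero]

/-- Grönwall's inequality in integral form. -/
theorem add_integral_le_mul_exp {Y : ℝ → ℝ} (hY : Continuous Y) {c κ : ℝ} (hκ : 0 ≤ κ)
    (h : ∀ t ∈ Icc 0 T, Y t ≤ c + κ * ∫ s in (0 : ℝ)..t, Y s) {t : ℝ} (ht : t ∈ Icc 0 T) :
    c + κ * ∫ s in (0 : ℝ)..t, Y s ≤ c * Real.exp (κ * t) := by
  have hd : ∀ t, HasDerivAt (fun t => c + κ * ∫ s in (0 : ℝ)..t, Y s) (κ * Y t) t := fun t =>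
    ((intervalIntegral.integral_hasDerivAt_right (hY.intervalIntegrable _ _)
      (hY.stronglyMeasurableAtFilter _ _) hY.continuousAt).const_mul κ).const_add c
  have := le_gronwallBound_of_liminf_deriv_right_le (f := fun t => c + κ * ∫ s in (0 : ℝ)..t, Y s)
    (f' := fun t => κ * Y t) (δ := c) (K := κ) (ε := 0) (a := 0) (b := T)
    (fun t _ => (hd t).continuousAt.continuousWithinAt)
    (fun t _ r hr => by
      simpa only [slope_def_field, div_eq_inv_mul] using
        (hd t).hasDerivWithinAt.liminf_right_slope_le hr)
    (by simp) (fun t ht => by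
      rw [add_zero]
      exact mul_le_mul_of_nonneg_left (h t ⟨ht.1, ht.2.le⟩) hκ) t ht
  rwa [gronwallBound_ε0, sub_zero] at this

section Estimates

variable {hT : 0 < T} {f : L2Time T (StrongDual ℝ V)} {ρ₀ : H} {ρ : WSub j T}

/-- The energy estimate in integral form, with `2⟨f,ρ⟩ ≤ ‖f‖²/α + α‖ρ‖²` absorbed into the coercive
term `2α‖ρ‖²`. -/
theorem IsEvolutionSolution.norm_sq_add_le (hα : 0 < α)
    (hB : ∀ t v, α * ‖v‖ ^ 2 ≤ B t v v + lam * ‖j v‖ ^ 2) (h : IsEvolutionSolution hT B f ρ₀ ρ)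
    {r : C(Icc 0 T, H)} (hr : ∀ᵐ t ∂leb 0 T, ∀ ht : t ∈ Icc 0 T, r ⟨t, ht⟩ = j (ρ.1.fst t))
    {t : ℝ} (ht : t ∈ Icc 0 T) :
    ‖IccExtend hT.le r t‖ ^ 2 + α * ∫ s in (0 : ℝ)..t, ‖ρ.1.fst s‖ ^ 2
      ≤ (‖r ⟨0, left_mem_Icc.2 hT.le⟩‖ ^ 2 + ‖f‖ ^ 2 / α)
        + 2 * lam * ∫ s in (0 : ℝ)..t, ‖IccExtend hT.le r s‖ ^ 2 := by
  obtain ⟨c, hc⟩ := WSub.exists_ae_eq_primitive hT ρ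
  have h1 := norm_sq_rep_eq hT (Lp.stronglyMeasurable ρ.1.fst) (Lp.stronglyMeasurable ρ.1.snd)
    (Lp.memLp ρ.1.fst) (Lp.memLp ρ.1.snd) hc hr ⟨t, ht⟩
  have hY : Continuous fun s => ‖IccExtend hT.le r s‖ ^ 2 := (r.continuous.Icc_extend').norm.pow 2
  have h0 := left_mem_Icc.2 hT.le
  have sq : ∀ {E : Type _} [NormedAddCommGroup E] (k : L2Time T E),
      Integrable (fun s => ‖k s‖ ^ 2) (leb 0 T) := fun k =>
    (memLp_two_iff_integrable_sq_norm (Lp.aestronglyMeasurable k)).1 (Lp.memLp k)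
  have iρ := intervalIntegrable_of_leb (sq ρ.1.fst) h0 ht
  have iff := intervalIntegrable_of_leb (sq f) h0 ht
  have ig := intervalIntegrable_of_leb
    (integrable_dual_apply (Lp.memLp ρ.1.snd) (Lp.memLp ρ.1.fst)) h0 ht
  have iY : IntervalIntegrable (fun s => ‖IccExtend hT.le r s‖ ^ 2) volume 0 t :=
    hY.intervalIntegrable _ _
  have i4 := ((iff.div_const α).sub (iρ.const_mul α)).add (iY.const_mul (2 * lam))
  have hle : ∫ s in (0 : ℝ)..t, 2 * ρ.1.snd s (ρ.1.fst s)
      ≤ ∫ s in (0 : ℝ)..t, (‖f s‖ ^ 2 / α - α * ‖ρ.1.fst s‖ ^ 2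
        + 2 * lam * ‖IccExtend hT.le r s‖ ^ 2) := by
    refine intervalIntegral.integral_mono_ae_restrict ht.1 (ig.const_mul 2) i4 ?_
    refine ae_restrict_of_ae_restrict_of_subset (Icc_subset_Icc_right ht.2) ?_
    rw [← restrict_Ioo_eq_restrict_Icc]
    filter_upwards [h.equation, hr, ae_restrict_mem measurableSet_Ioo] with s h2 h3 h4
    rw [IccExtend_of_mem _ _ (Ioo_subset_Icc_self h4), h3]
    have h5 : ρ.1.snd s (ρ.1.fst s) = f s (ρ.1.fst s) - B s (ρ.1.fst s) (ρ.1.fst s) := by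
      rw [← h2, add_apply, add_sub_cancel_right]
    have h6 : f s (ρ.1.fst s) ≤ ‖f s‖ * ‖ρ.1.fst s‖ :=
      (le_abs_self _).trans ((f s).le_opNorm _)
    have h7 : 2 * (‖f s‖ * ‖ρ.1.fst s‖) ≤ ‖f s‖ ^ 2 / α + α * ‖ρ.1.fst s‖ ^ 2 := by
      have : ‖f s‖ ^ 2 / α + α * ‖ρ.1.fst s‖ ^ 2 - 2 * (‖f s‖ * ‖ρ.1.fst s‖)
          = (‖f s‖ - α * ‖ρ.1.fst s‖) ^ 2 / α := by
        field_simp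
        ring
      have h8 : 0 ≤ (‖f s‖ - α * ‖ρ.1.fst s‖) ^ 2 / α := by positivity
      linarith
    rw [h5]
    linarith [hB s (ρ.1.fst s)]
  have hff : ∫ s in (0 : ℝ)..t, ‖f s‖ ^ 2 ≤ ‖f‖ ^ 2 := by
    have h2 := integral_norm_mul_norm_le f f
    simp only [← pow_two] at h2
    refine le_trans ?_ h2
    rw [intervalIntegral.integral_of_le ht.1, ← integral_Ioc_eq_integral_Ioo]
    exact setIntegral_mono_set ((integrableOn_Ioc_iff_integrableOn_Ioo).2 (sq f))
      (Eventually.of_forall fun s => by positivity) (Ioc_subset_Ioc_right ht.2).eventuallyLE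
  have hff' : (∫ s in (0 : ℝ)..t, ‖f s‖ ^ 2) / α ≤ ‖f‖ ^ 2 / α := by gcongr
  rw [intervalIntegral.integral_const_mul, intervalIntegral.integral_add
    ((iff.div_const α).sub (iρ.const_mul α)) (iY.const_mul (2 * lam)),
    intervalIntegral.integral_sub (iff.div_const α) (iρ.const_mul α),
    intervalIntegral.integral_div, intervalIntegral.integral_const_mul,
    intervalIntegral.integral_const_mul] at hle
  rw [IccExtend_of_mem _ _ ht, h1]
  linarith

/-- The a priori bounds in `C([0,T];H)` and in `L²(0,T;V)`. -/
theorem IsEvolutionSolution.norm_rep_le (hlam : 0 ≤ lam) (hα : 0 < α)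
    (hB : ∀ t v, α * ‖v‖ ^ 2 ≤ B t v v + lam * ‖j v‖ ^ 2) (h : IsEvolutionSolution hT B f ρ₀ ρ)
    {r : C(Icc 0 T, H)} (hr : ∀ᵐ t ∂leb 0 T, ∀ ht : t ∈ Icc 0 T, r ⟨t, ht⟩ = j (ρ.1.fst t))
    (hr₀ : r ⟨0, left_mem_Icc.2 hT.le⟩ = ρ₀) :
    ‖r‖ ≤ Real.exp (lam * T) * (‖ρ₀‖ + ‖f‖ / √α) ∧
      ‖ρ.1.fst‖ ≤ Real.exp (lam * T) * (‖ρ₀‖ + ‖f‖ / √α) / √α := by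
  set S := Real.exp (lam * T) * (‖ρ₀‖ + ‖f‖ / √α) with hS
  have hS0 : 0 ≤ S := by positivity
  have hα' : √α ^ 2 = α := Real.sq_sqrt hα.le
  set c := ‖ρ₀‖ ^ 2 + ‖f‖ ^ 2 / α with hcd
  have hc0 : 0 ≤ c := by positivity
  have hY : Continuous fun s => ‖IccExtend hT.le r s‖ ^ 2 := (r.continuous.Icc_extend').norm.pow 2
  have hmain : ∀ t ∈ Icc 0 T, ‖IccExtend hT.le r t‖ ^ 2 + α * ∫ s in (0 : ℝ)..t, ‖ρ.1.fst s‖ ^ 2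
      ≤ c + 2 * lam * ∫ s in (0 : ℝ)..t, ‖IccExtend hT.le r s‖ ^ 2 := by
    intro t ht
    have := h.norm_sq_add_le hα hB hr ht
    rwa [hr₀] at this
  have hq : ∀ t ∈ Icc 0 T, 0 ≤ α * ∫ s in (0 : ℝ)..t, ‖ρ.1.fst s‖ ^ 2 := fun t ht =>
    mul_nonneg hα.le (intervalIntegral.integral_nonneg ht.1 fun s _ => by positivity)
  have hcS : c * Real.exp (2 * lam * T) ≤ S ^ 2 := by
    have h1 : Real.exp (2 * lam * T) = Real.exp (lam * T) ^ 2 := by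
      rw [← Real.exp_nat_mul]
      congr 1
      push_cast
      ring
    have h2 : c ≤ (‖ρ₀‖ + ‖f‖ / √α) ^ 2 := by
      have h3 : (‖f‖ / √α) ^ 2 = ‖f‖ ^ 2 / α := by rw [div_pow, hα']
      have h4 : 0 ≤ ‖ρ₀‖ * (‖f‖ / √α) := by positivity
      rw [hcd, ← h3]
      linarith [add_sq ‖ρ₀‖ (‖f‖ / √α)]
    rw [hS, mul_pow, h1, mul_comm]
    gcongr
  have hg : ∀ t ∈ Icc 0 T, ‖IccExtend hT.le r t‖ ^ 2 + α * ∫ s in (0 : ℝ)..t, ‖ρ.1.fst s‖ ^ 2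
      ≤ S ^ 2 := by
    intro t ht
    have h1 := add_integral_le_mul_exp hY (c := c) (κ := 2 * lam) (by positivity)
      (fun t ht => by linarith [hmain t ht, hq t ht]) ht
    have h2 : c * Real.exp (2 * lam * t) ≤ c * Real.exp (2 * lam * T) := by
      have := ht.2
      gcongr
    exact (hmain t ht).trans (h1.trans (h2.trans hcS))
  constructor
  · refine (ContinuousMap.norm_le _ hS0).2 fun t => abs_le_of_sq_le_sq' ?_ hS0 |>.2
    have h1 := hg t t.2
    rw [IccExtend_of_mem _ _ t.2] at h1
    linarith [hq t t.2]
  · have h1 := hg T (right_mem_Icc.2 hT.le)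
    rw [← integral_Ioo_eq_intervalIntegral _ hT.le, integral_norm_sq_eq] at h1
    rw [le_div_iff₀ (Real.sqrt_pos.2 hα)]
    refine abs_le_of_sq_le_sq' ?_ hS0 |>.2
    rw [mul_pow, hα', mul_comm]
    linarith [sq_nonneg ‖IccExtend hT.le r T‖]

theorem IsEvolutionSolution.norm_snd_le (hBK : ∀ t, ‖B t‖ ≤ K)
    (h : IsEvolutionSolution hT B f ρ₀ ρ) : ‖ρ.1.snd‖ ≤ ‖f‖ + K * ‖ρ.1.fst‖ := by
  have h1 : ‖ρ.1.snd - f‖ ≤ K * ‖ρ.1.fst‖ := by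
    refine Lp.norm_le_mul_norm_of_ae_le_mul ?_
    filter_upwards [h.equation, Lp.coeFn_sub ρ.1.snd f] with t h2 h3
    rw [h3, Pi.sub_apply, ← h2, sub_add_cancel_left, norm_neg]
    exact (B t).le_of_opNorm_le (hBK t) _
  have h2 := norm_add_le f (ρ.1.snd - f)
  rw [add_sub_cancel] at h2
  linarith

theorem IsEvolutionSolution.sub {ρ' : WSub j T} (h : IsEvolutionSolution hT B f ρ₀ ρ)
    (h' : IsEvolutionSolution hT B f ρ₀ ρ') : IsEvolutionSolution hT B 0 (0 : H) (ρ - ρ') := by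
  obtain ⟨r, hr, hr₀⟩ := h.initial
  obtain ⟨r', hr', hr₀'⟩ := h'.initial
  have hf : ((ρ - ρ').1.fst : ℝ → V) =ᵐ[leb 0 T] ρ.1.fst - ρ'.1.fst :=
    Lp.coeFn_sub ρ.1.fst ρ'.1.fst
  have hs : ((ρ - ρ').1.snd : ℝ → StrongDual ℝ V) =ᵐ[leb 0 T] ρ.1.snd - ρ'.1.snd :=
    Lp.coeFn_sub ρ.1.snd ρ'.1.snd
  refine ⟨?_, r - r', ?_, ?_⟩
  · filter_upwards [h.equation, h'.equation, hf, hs,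
      Lp.coeFn_zero (StrongDual ℝ V) 2 (leb 0 T)] with t h1 h2 h3 h4 h5
    rw [h3, h4, h5, Pi.sub_apply, Pi.sub_apply, map_sub, sub_add_sub_comm, h1, h2, sub_self]
    rfl
  · filter_upwards [hr, hr', hf] with t h1 h2 h3 ht
    rw [h3, ContinuousMap.sub_apply, h1, h2, Pi.sub_apply, map_sub]
  · rw [ContinuousMap.sub_apply, hr₀, hr₀', sub_self]

/-- Uniqueness for the abstract evolution equation: the a priori bounds for the difference vanish.
-/
theorem IsEvolutionSolution.unique (hBK : ∀ t, ‖B t‖ ≤ K) (hlam : 0 ≤ lam) (hα : 0 < α)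
    (hB : ∀ t v, α * ‖v‖ ^ 2 ≤ B t v v + lam * ‖j v‖ ^ 2) {ρ' : WSub j T}
    (h : IsEvolutionSolution hT B f ρ₀ ρ) (h' : IsEvolutionSolution hT B f ρ₀ ρ') : ρ = ρ' := by
  have hd := h.sub h'
  obtain ⟨r, hr, hr₀⟩ := hd.initial
  have h1 := (hd.norm_rep_le hlam hα hB hr hr₀).2
  simp only [norm_zero, zero_div, add_zero, mul_zero] at h1
  have h2 := hd.norm_snd_le hBK
  have h3 : (ρ - ρ').1.fst = 0 := norm_le_zero_iff.1 h1
  rw [h3, norm_zero, norm_zero, mul_zero, add_zero] at h2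
  have h4 : (ρ - ρ').1.snd = 0 := norm_le_zero_iff.1 h2
  refine sub_eq_zero.1 (Subtype.ext ?_)
  exact (WithLp.ofLp_injective 2) (Prod.ext h3 h4)

end Estimates

end Evolution

/-! ### The space `𝕍` -/

section SpaceV

open Filter Topology

variable {N : ℕ} {l : Fin N → ℝ}

theorem secondCountableTopology_V (l : Fin N → ℝ) : SecondCountableTopology (V l) := by
  have : Fact ((2 : ℝ≥0∞) ≠ ⊤) := ⟨by norm_num⟩
  have h0 : ∀ i, SecondCountableTopology (Lp ℝ 2 (leb 0 (l i))) := fun i => inferInstance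
  have h1 : SecondCountableTopology (L2 l) :=
    (PiLp.homeomorph 2 (fun i : Fin N => Lp ℝ 2 (leb 0 (l i)))).secondCountableTopology
  have h2 : SecondCountableTopology (WithLp 2 (L2 l × L2 l)) :=
    (WithLp.homeomorphProd 2 (L2 l) (L2 l)).secondCountableTopology
  exact inferInstanceAs (SecondCountableTopology ↥(VSub l))

/-- Integration against a square integrable function (not a class) is continuous on `L²`. -/
theorem continuous_integral_mul {b : ℝ} {k : ℝ → ℝ} (hk : MemLp k 2 (leb 0 b)) :
    Continuous fun v : Lp ℝ 2 (leb 0 b) => ∫ x in Ioo 0 b, v x * k x := by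
  have : (fun v : Lp ℝ 2 (leb 0 b) => ∫ x in Ioo 0 b, v x * k x)
      = fun v => inner ℝ (hk.toLp k) v := by
    ext v
    rw [L2.inner_def]
    refine integral_congr_ae (hk.coeFn_toLp.mono fun x hx => ?_)
    dsimp only
    rw [hx]
    rfl
  rw [this]
  fun_prop

theorem IsWeakDeriv.exists_ae_eq_primitive {b : ℝ} (hb : 0 < b) {v w : Lp ℝ 2 (leb 0 b)}
    (h : IsWeakDeriv v w) : ∃ c, v =ᵐ[leb 0 b] fun x => c + ∫ s in (0 : ℝ)..x, w s := by
  refine IsWeakTimeDeriv.exists_ae_eq_primitive hb (MemLp.integrable_leb (Lp.memLp v))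
    (MemLp.integrable_leb (Lp.memLp w)) fun θ => ?_
  have := h θ
  simp only [smul_eq_mul]
  simpa only [mul_comm] using this

/-- Integration by parts against the weight `x`: the value at `b` of the continuous representative
of `v` is `(∫ v + ∫ x w) / b`, a continuous functional of `(v, w)` in `L² × L²`. -/
theorem integral_add_integral_mul_eq {b : ℝ} (hb : 0 < b) {v w : Lp ℝ 2 (leb 0 b)} {c : ℝ}
    (h : v =ᵐ[leb 0 b] fun x => c + ∫ s in (0 : ℝ)..x, w s) :
    (∫ x in Ioo 0 b, v x * 1) + ∫ x in Ioo 0 b, w x * x = b * (c + ∫ s in (0 : ℝ)..b, w s) := by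
  have hw := MemLp.integrable_leb (Lp.memLp w)
  have h1 := integral_deriv_smul_primitive (θ := fun x => x) contDiff_id hw
  have hp : Integrable (fun t => ∫ s in (0 : ℝ)..t, w s) (leb 0 b) :=
    ((continuousOn_primitive_leb hb.le hw).integrableOn_Icc).mono_set Ioo_subset_Icc_self
  have h2 : ∫ x in Ioo 0 b, v x * 1 = ∫ x in Ioo 0 b, (c + ∫ s in (0 : ℝ)..x, w s) :=
    integral_congr_ae (h.mono fun x hx => by dsimp only; rw [hx, mul_one])
  have hwx : Integrable (fun x => w x * x) (leb 0 b) :=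
    (Lp.memLp w).integrable_mul (memLp_leb_of_continuous continuous_id b)
  rw [h2, integral_add (integrable_const c) hp]
  simp only [deriv_id'', one_mul, smul_eq_mul, sub_mul] at h1
  rw [h1, integral_sub (hw.const_mul b) (by simpa only [mul_comm] using hwx), integral_const_mul,
    integral_const, integral_Ioo_eq_intervalIntegral _ hb.le]
  simp only [measureReal_restrict_apply_univ, Real.volume_real_Ioo_of_le hb.le, smul_eq_mul,
    sub_zero]
  have h3 : ∫ x in Ioo 0 b, w x * x = ∫ x in Ioo 0 b, x * w x := by simp only [mul_comm]
  rw [h3]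
  ring

/-- The conditions defining `𝕍`, written in terms of functionals continuous on `𝕃² × 𝕃²`. The first
family says `φᵢ(lᵢ) = 0`; then `φᵢ(0)` is the negative of the integral of `∂ₓφᵢ`. -/
theorem mem_VSub_iff (hl : ∀ i, 0 < l i) (φ : WithLp 2 (L2 l × L2 l)) :
    φ ∈ VSub l ↔ φ ∈ H1 l ∧
      (∀ i, (∫ x in Ioo 0 (l i), φ.fst i x * 1) + ∫ x in Ioo 0 (l i), φ.snd i x * x = 0) ∧
      ∀ i j, ∫ x in Ioo 0 (l i), φ.snd i x * 1 = ∫ x in Ioo 0 (l j), φ.snd j x * 1 := by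
  have hint : ∀ i, ∫ x in Ioo 0 (l i), φ.snd i x * 1 = ∫ s in (0 : ℝ)..(l i), φ.snd i s := fun i => by
    simp only [mul_one]
    exact integral_Ioo_eq_intervalIntegral _ (hl i).le
  have hcont : ∀ (i : Fin N) (c : ℝ),
      ContinuousOn (fun x => c + ∫ s in (0 : ℝ)..x, φ.snd i s) (Icc 0 (l i)) := fun i c =>
    continuousOn_const.add
      (continuousOn_primitive_leb (hl i).le (MemLp.integrable_leb (Lp.memLp (φ.snd i))))
  constructor
  · rintro ⟨h, v, hv, h0, hvl⟩
    have key : ∀ i, (∫ x in Ioo 0 (l i), φ.fst i x * 1) + ∫ x in Ioo 0 (l i), φ.snd i x * x = 0 ∧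
        v i 0 = -∫ s in (0 : ℝ)..(l i), φ.snd i s := by
      intro i
      obtain ⟨c, hc⟩ := (h i).exists_ae_eq_primitive (hl i)
      have he : EqOn (v i) (fun x => c + ∫ s in (0 : ℝ)..x, φ.snd i s) (Icc 0 (l i)) := by
        refine Measure.eqOn_Icc_of_ae_eq volume (hl i).ne ?_ (hv i).1 (hcont i c)
        rw [← restrict_Ioo_eq_restrict_Icc]
        exact (hv i).2.symm.trans hc
      have e1 := he (right_mem_Icc.2 (hl i).le)
      have e0 := he (left_mem_Icc.2 (hl i).le)
      rw [hvl i] at e1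
      dsimp only at e0 e1
      rw [intervalIntegral.integral_same, add_zero] at e0
      refine ⟨?_, ?_⟩
      · rw [integral_add_integral_mul_eq (hl i) hc, ← e1, mul_zero]
      · rw [e0]
        linarith
    refine ⟨h, fun i => (key i).1, fun i j => ?_⟩
    rw [hint, hint]
    have := h0 i j
    rw [(key i).2, (key j).2] at this
    exact neg_injective this
  · rintro ⟨h, h1, h2⟩
    refine ⟨h, fun i x => -(∫ s in (0 : ℝ)..(l i), φ.snd i s) + ∫ s in (0 : ℝ)..x, φ.snd i s,
      fun i => ⟨hcont i _, ?_⟩, fun i j => ?_, fun i => neg_add_cancel _⟩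
    · obtain ⟨c, hc⟩ := (h i).exists_ae_eq_primitive (hl i)
      have h3 := h1 i
      rw [integral_add_integral_mul_eq (hl i) hc, mul_eq_zero, or_iff_right (hl i).ne'] at h3
      rw [eq_neg_of_add_eq_zero_left h3] at hc
      exact hc
    · dsimp only
      rw [intervalIntegral.integral_same, intervalIntegral.integral_same, ← hint, ← hint, h2 i j]

/-- `𝕍` is closed in `𝕃² × 𝕃²`, hence a Hilbert space. -/
theorem completeSpace_V (hl : ∀ i, 0 < l i) : CompleteSpace (V l) := by
  have c1 : ∀ i, Continuous fun φ : WithLp 2 (L2 l × L2 l) => φ.fst i := fun i =>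
    (PiLp.continuous_apply 2 _ i).comp (WithLp.continuous_fst 2 _ _)
  have c2 : ∀ i, Continuous fun φ : WithLp 2 (L2 l × L2 l) => φ.snd i := fun i =>
    (PiLp.continuous_apply 2 _ i).comp (WithLp.continuous_snd 2 _ _)
  have m1 : ∀ i, MemLp (fun _ : ℝ => (1 : ℝ)) 2 (leb 0 (l i)) := fun i => memLp_const 1
  have m2 : ∀ i, MemLp (fun x : ℝ => x) 2 (leb 0 (l i)) := fun i =>
    memLp_leb_of_continuous continuous_id _
  have hcl : IsClosed (VSub l : Set (WithLp 2 (L2 l × L2 l))) := by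
    have : (VSub l : Set (WithLp 2 (L2 l × L2 l))) = {φ | (∀ i, IsWeakDeriv (φ.fst i) (φ.snd i)) ∧
      (∀ i, (∫ x in Ioo 0 (l i), φ.fst i x * 1) + ∫ x in Ioo 0 (l i), φ.snd i x * x = 0) ∧
      ∀ i j, ∫ x in Ioo 0 (l i), φ.snd i x * 1 = ∫ x in Ioo 0 (l j), φ.snd j x * 1} :=
      Set.ext fun φ => mem_VSub_iff hl φ
    rw [this]
    simp only [IsWeakDeriv, ofPred_and, ofPred_forall]
    refine IsClosed.inter ?_ (IsClosed.inter ?_ ?_)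
    · refine isClosed_iInter fun i => isClosed_iInter fun ψ => isClosed_eq ?_ ?_
      · exact (continuous_integral_mul (testFunction_deriv_memLp ψ 2 (leb 0 (l i)))).comp (c1 i)
      · exact ((continuous_integral_mul (testFunction_memLp ψ 2 (leb 0 (l i)))).comp (c2 i)).neg
    · refine isClosed_iInter fun i => isClosed_eq (Continuous.add ?_ ?_) continuous_const
      · exact (continuous_integral_mul (m1 i)).comp (c1 i)
      · exact (continuous_integral_mul (m2 i)).comp (c2 i)
    · refine isClosed_iInter fun i => isClosed_iInter fun j => isClosed_eq ?_ ?_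
      · exact (continuous_integral_mul (m1 i)).comp (c2 i)
      · exact (continuous_integral_mul (m1 j)).comp (c2 j)
  exact hcl.completeSpace_coe

theorem isWeakDeriv_testFunction {b : ℝ} (hb : 0 ≤ b) (ψ : 𝓓(interval 0 b, ℝ)) :
    IsWeakDeriv ((testFunction_memLp ψ 2 (leb 0 b)).toLp ψ)
      ((testFunction_deriv_memLp ψ 2 (leb 0 b)).toLp (deriv ψ)) := by
  intro χ
  have e1 : ∫ x in Ioo 0 b, ((testFunction_memLp ψ 2 (leb 0 b)).toLp ψ) x * deriv χ x
      = ∫ x in Ioo 0 b, ψ x * deriv χ x :=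
    integral_congr_ae ((testFunction_memLp ψ 2 (leb 0 b)).coeFn_toLp.mono fun x hx => by
      dsimp only; rw [hx])
  have e2 : ∫ x in Ioo 0 b, ((testFunction_deriv_memLp ψ 2 (leb 0 b)).toLp (deriv ψ)) x * χ x
      = ∫ x in Ioo 0 b, deriv ψ x * χ x :=
    integral_congr_ae ((testFunction_deriv_memLp ψ 2 (leb 0 b)).coeFn_toLp.mono fun x hx => by
      dsimp only; rw [hx])
  have hd : ∀ (η : 𝓓(interval 0 b, ℝ)) x, HasDerivAt η (deriv η x) x := fun η x =>
    (η.contDiff.differentiable (by simp) x).hasDerivAt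
  have hc : ∀ η : 𝓓(interval 0 b, ℝ), Continuous (deriv η) := fun η =>
    η.contDiff.continuous_deriv (by simp)
  have h0 : ∀ x ∉ Ioo 0 b, χ x = 0 := fun x hx =>
    image_eq_zero_of_notMem_tsupport fun h => hx (χ.tsupport_subset h)
  rw [e1, e2, integral_Ioo_eq_intervalIntegral _ hb, integral_Ioo_eq_intervalIntegral _ hb,
    intervalIntegral.integral_mul_deriv_eq_deriv_mul (fun x _ => hd ψ x) (fun x _ => hd χ x)
      ((hc ψ).intervalIntegrable _ _) ((hc χ).intervalIntegrable _ _),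
    h0 0 fun h => lt_irrefl _ h.1, h0 b fun h => lt_irrefl _ h.2]
  simp

/-- The test function `ψ` on the `i`-th edge, extended by zero to the other edges, belongs to `𝕍`.
-/
theorem single_testFunction_mem_VSub (hl : ∀ i, 0 < l i) (i : Fin N) (ψ : 𝓓(interval 0 (l i), ℝ)) :
    WithLp.toLp 2 (WithLp.toLp 2 (Pi.single i ((testFunction_memLp ψ 2 (leb 0 (l i))).toLp ψ)),
      WithLp.toLp 2 (Pi.single i ((testFunction_deriv_memLp ψ 2 (leb 0 (l i))).toLp (deriv ψ))))
      ∈ VSub l := by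
  have h0 : ∀ x ∉ Ioo 0 (l i), ψ x = 0 := fun x hx =>
    image_eq_zero_of_notMem_tsupport fun h => hx (ψ.tsupport_subset h)
  refine ⟨fun k => ?_, Pi.single i ψ, fun k => ⟨?_, ?_⟩, ?_, ?_⟩
  · rcases eq_or_ne k i with rfl | hk
    · simpa using isWeakDeriv_testFunction (hl k).le ψ
    · simpa [hk] using IsWeakDeriv.zero
  · rcases eq_or_ne k i with rfl | hk
    · simpa using ψ.continuous.continuousOn
    · rw [Pi.single_eq_of_ne hk]
      exact continuousOn_const
  · rcases eq_or_ne k i with rfl | hk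
    · simpa using MemLp.coeFn_toLp (testFunction_memLp ψ 2 (leb 0 (l k)))
    · simpa [hk] using Lp.coeFn_zero ℝ 2 (leb 0 (l k))
  · have : ∀ k, (Pi.single i (ψ : ℝ → ℝ) : Fin N → ℝ → ℝ) k 0 = 0 := fun k => by
      rcases eq_or_ne k i with rfl | hk
      · simpa using h0 0 fun h => lt_irrefl _ h.1
      · simp [hk]
    intro k k'
    rw [this, this]
  · intro k
    rcases eq_or_ne k i with rfl | hk
    · simpa using h0 _ fun h => lt_irrefl _ h.2
    · simp [hk]

/-- `𝕍` is dense in `𝕃²`, since it contains the test functions on each edge. -/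
theorem denseRange_toL2 (hl : ∀ i, 0 < l i) : DenseRange (toL2 : V l → L2 l) := by
  have h : (LinearMap.range (toL2 : V l →L[ℝ] L2 l).toLinearMap)ᗮ = ⊥ := by
    rw [Submodule.eq_bot_iff]
    intro q hq
    have hq' : ∀ v : V l, inner ℝ (toL2 v) q = 0 := fun v =>
      (Submodule.mem_orthogonal _ _).1 hq _ ⟨v, rfl⟩
    ext1 i
    have key : ∀ᵐ x, x ∈ Ioo 0 (l i) → q i x = 0 := by
      refine isOpen_Ioo.ae_eq_zero_of_integral_contDiff_smul_eq_zero
        (IntegrableOn.locallyIntegrableOn (MemLp.integrable_leb (Lp.memLp (q i))))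
        fun ψ h1 h2 h3 => ?_
      let χ : 𝓓(interval 0 (l i), ℝ) := ⟨ψ, h1, h2, h3⟩
      have hχ := testFunction_memLp χ 2 (leb 0 (l i))
      let v : V l := ⟨_, single_testFunction_mem_VSub hl i χ⟩
      have hv : ∀ k, toL2 v k = (Pi.single i (hχ.toLp χ) : ∀ k, Lp ℝ 2 (leb 0 (l k))) k :=
        fun k => rfl
      have h4 := hq' v
      rw [PiLp.inner_apply, Finset.sum_eq_single i] at h4
      · rw [← setIntegral_eq_integral_of_forall_compl_eq_zero (s := Ioo 0 (l i))]
        · rw [hv, Pi.single_eq_same, L2.inner_def] at h4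
          refine Eq.trans ?_ h4
          refine integral_congr_ae (hχ.coeFn_toLp.mono fun x hx => ?_)
          dsimp only
          rw [hx]
          exact mul_comm _ _
        · intro x hx
          rw [image_eq_zero_of_notMem_tsupport fun h => hx (h3 h), zero_smul]
      · intro k _ hk
        rw [hv, Pi.single_eq_of_ne hk, inner_zero_left]
      · simp
    refine Lp.ext ?_
    rw [← ae_restrict_iff' measurableSet_Ioo] at key
    exact Filter.EventuallyEq.trans key (Lp.coeFn_zero ℝ 2 (leb 0 (l i))).symm
  have h2 := Submodule.topologicalClosure_eq_top_iff.2 h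
  rw [← Submodule.dense_iff_topologicalClosure_eq_top] at h2
  exact h2

end SpaceV

/-! ### The form `𝓕[u]` -/

section Form

open Filter Topology

variable {N : ℕ} {l : Fin N → ℝ} {T : ℝ}

/-- Truncation of an `L^∞` function at its norm gives a representative bounded everywhere. -/
theorem exists_bounded_representative {α : Type*} [MeasurableSpace α] {μ : Measure α}
    (u : Lp ℝ ⊤ μ) :
    ∃ k : α → ℝ, StronglyMeasurable k ∧ (∀ z, |k z| ≤ ‖u‖) ∧ ∀ᵐ z ∂μ, u z = k z := by
  refine ⟨fun z => max (-‖u‖) (min ‖u‖ (u z)), ?_, fun z => ?_, ?_⟩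
  · exact stronglyMeasurable_const.sup (stronglyMeasurable_const.inf (Lp.stronglyMeasurable u))
  · exact abs_le.2 ⟨le_max_left _ _, max_le (by linarith [norm_nonneg u]) (min_le_left _ _)⟩
  · filter_upwards [ae_le_eLpNormEssSup (f := u) (μ := μ)] with z hz
    have h1 : ‖u z‖ ≤ ‖u‖ := by
      rw [Lp.norm_def, eLpNorm_exponent_top, ← toReal_enorm]
      refine ENNReal.toReal_mono ?_ hz
      rw [← eLpNorm_exponent_top]
      exact Lp.eLpNorm_ne_top u
    rw [Real.norm_eq_abs] at h1
    rw [min_eq_right (abs_le.1 h1).2, max_eq_right (abs_le.1 h1).1]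

/-- Multiplication by a bounded function, as a bounded operator on `L²(0,b)`. -/
theorem exists_mul_clm (b : ℝ) {k : ℝ → ℝ} (hk : StronglyMeasurable k) {M : ℝ}
    (hM : ∀ x, |k x| ≤ M) : ∃ m : Lp ℝ 2 (leb 0 b) →L[ℝ] Lp ℝ 2 (leb 0 b),
      (∀ v, ‖m v‖ ≤ M * ‖v‖) ∧ ∀ v, m v =ᵐ[leb 0 b] fun x => k x * v x := by
  have hkT : MemLp k ⊤ (leb 0 b) :=
    memLp_top_of_bound hk.aestronglyMeasurable M (Eventually.of_forall hM)
  have hL : ∀ v : Lp ℝ 2 (leb 0 b), MemLp (fun x => k x * v x) 2 (leb 0 b) := fun v =>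
    (Lp.memLp v).mul hkT
  have hc : ∀ v, ((hL v).toLp _ : ℝ → ℝ) =ᵐ[leb 0 b] fun x => k x * v x := fun v =>
    (hL v).coeFn_toLp
  have hb : ∀ v, ‖(hL v).toLp _‖ ≤ M * ‖v‖ := fun v => by
    refine Lp.norm_le_mul_norm_of_ae_le_mul ?_
    filter_upwards [hc v] with x hx
    rw [hx, norm_mul]
    exact mul_le_mul_of_nonneg_right (hM x) (norm_nonneg _)
  refine ⟨LinearMap.mkContinuous
    { toFun := fun v => (hL v).toLp _
      map_add' := fun v w => ?_
      map_smul' := fun c v => ?_ } M hb, hb, hc⟩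
  · refine Lp.ext ?_
    filter_upwards [hc (v + w), hc v, hc w, Lp.coeFn_add v w,
      Lp.coeFn_add ((hL v).toLp _) ((hL w).toLp _)] with x h1 h2 h3 h4 h5
    rw [h1, h5, Pi.add_apply, h2, h3, h4, Pi.add_apply, mul_add]
  · refine Lp.ext ?_
    filter_upwards [hc (c • v), hc v, Lp.coeFn_smul c v, Lp.coeFn_smul c ((hL v).toLp _)]
      with x h1 h2 h3 h4
    rw [h1, RingHom.id_apply, h4, Pi.smul_apply, h2, h3, Pi.smul_apply, smul_eq_mul, smul_eq_mul]
    ring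

theorem sum_norm_mul_norm_le (a b : L2 l) : ∑ i, ‖a i‖ * ‖b i‖ ≤ ‖a‖ * ‖b‖ := by
  rw [PiLp.norm_eq_of_L2, PiLp.norm_eq_of_L2]
  exact Real.sum_mul_le_sqrt_mul_sqrt _ _ _

theorem norm_sq_V (v : V l) : ‖v‖ ^ 2 = ‖toL2 v‖ ^ 2 + ‖dx v‖ ^ 2 :=
  WithLp.prod_norm_sq_eq_of_L2 (v : ↥(VSub l)).1

theorem norm_toL2_le (v : V l) : ‖toL2 v‖ ≤ ‖v‖ :=
  abs_le_of_sq_le_sq' (by linarith [norm_sq_V v, sq_nonneg ‖dx v‖]) (norm_nonneg _) |>.2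

theorem norm_dx_le (v : V l) : ‖dx v‖ ≤ ‖v‖ :=
  abs_le_of_sq_le_sq' (by linarith [norm_sq_V v, sq_nonneg ‖toL2 v‖]) (norm_nonneg _) |>.2

/-- The form at a fixed time, with multiplication by the drift replaced by bounded operators `mᵢ`.
-/
theorem exists_form_clm {D : Fin N → ℝ} {Dmin Dmax M : ℝ}
    (hDmin : ∀ i, Dmin ≤ D i) (hDmax : ∀ i, D i ≤ Dmax) (hD : 0 < Dmin) (hDM : 0 ≤ Dmax)
    (hM : 0 ≤ M)
    (m : ∀ i, Lp ℝ 2 (leb 0 (l i)) →L[ℝ] Lp ℝ 2 (leb 0 (l i))) (hm : ∀ i v, ‖m i v‖ ≤ M * ‖v‖) :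
    ∃ b : V l →L[ℝ] V l →L[ℝ] ℝ,
      (∀ v w, b v w = ∑ i, (D i * inner ℝ (dx v i) (dx w i) + inner ℝ (m i (toL2 v i)) (dx w i))) ∧
      ‖b‖ ≤ Dmax + M ∧
      ∀ v, Dmin / 2 * ‖v‖ ^ 2 ≤ b v v + (M ^ 2 / (2 * Dmin) + Dmin / 2) * ‖toL2 v‖ ^ 2 := by
  have hmul : ∀ v w : V l, ∑ i, |inner ℝ (m i (toL2 v i)) (dx w i)| ≤ M * (‖toL2 v‖ * ‖dx w‖) := by
    intro v w
    refine le_trans (Finset.sum_le_sum fun i _ => ?_)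
      (le_of_eq_of_le (Finset.mul_sum _ (fun i => ‖toL2 v i‖ * ‖dx w i‖) M).symm
        (mul_le_mul_of_nonneg_left (sum_norm_mul_norm_le _ _) hM))
    refine (abs_real_inner_le_norm _ _).trans ?_
    rw [← mul_assoc]
    exact mul_le_mul_of_nonneg_right (hm i _) (norm_nonneg _)
  have hdiff : ∀ v w : V l, ∑ i, |D i * inner ℝ (dx v i) (dx w i)| ≤ Dmax * (‖dx v‖ * ‖dx w‖) := by
    intro v w
    refine le_trans (Finset.sum_le_sum fun i _ => ?_)
      (le_of_eq_of_le (Finset.mul_sum _ (fun i => ‖dx v i‖ * ‖dx w i‖) Dmax).symm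
        (mul_le_mul_of_nonneg_left (sum_norm_mul_norm_le _ _) hDM))
    rw [abs_mul, abs_of_nonneg (hD.le.trans (hDmin i))]
    exact mul_le_mul (hDmax i) (abs_real_inner_le_norm _ _) (abs_nonneg _) hDM
  have hbound : ∀ v w : V l,
      ‖∑ i, (D i * inner ℝ (dx v i) (dx w i) + inner ℝ (m i (toL2 v i)) (dx w i))‖
        ≤ (Dmax + M) * ‖v‖ * ‖w‖ := by
    intro v w
    rw [Finset.sum_add_distrib, Real.norm_eq_abs]
    have h1 := (Finset.abs_sum_le_sum_abs _ _).trans (hdiff v w)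
    have h2 := (Finset.abs_sum_le_sum_abs _ _).trans (hmul v w)
    have h3 : ‖dx v‖ * ‖dx w‖ ≤ ‖v‖ * ‖w‖ :=
      mul_le_mul (norm_dx_le v) (norm_dx_le w) (norm_nonneg _) (norm_nonneg _)
    have h4 : ‖toL2 v‖ * ‖dx w‖ ≤ ‖v‖ * ‖w‖ :=
      mul_le_mul (norm_toL2_le v) (norm_dx_le w) (norm_nonneg _) (norm_nonneg _)
    refine (abs_add_le _ _).trans ((add_le_add (h1.trans (mul_le_mul_of_nonneg_left h3 hDM))
      (h2.trans (mul_le_mul_of_nonneg_left h4 hM))).trans (le_of_eq ?_))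
    ring
  have hDM' : 0 ≤ Dmax + M := add_nonneg hDM hM
  let L : V l →ₗ[ℝ] V l →ₗ[ℝ] ℝ := LinearMap.mk₂ ℝ
    (fun v w => ∑ i, (D i * inner ℝ (dx v i) (dx w i) + inner ℝ (m i (toL2 v i)) (dx w i)))
    (fun v v' w => by
      rw [← Finset.sum_add_distrib]
      refine Finset.sum_congr rfl fun i _ => ?_
      simp only [map_add, PiLp.add_apply, inner_add_left]
      ring)
    (fun c v w => by
      rw [smul_eq_mul, Finset.mul_sum]
      refine Finset.sum_congr rfl fun i _ => ?_
      simp only [map_smul, PiLp.smul_apply, real_inner_smul_left]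
      ring)
    (fun v w w' => by
      rw [← Finset.sum_add_distrib]
      refine Finset.sum_congr rfl fun i _ => ?_
      simp only [map_add, PiLp.add_apply, inner_add_right]
      ring)
    (fun c v w => by
      rw [smul_eq_mul, Finset.mul_sum]
      refine Finset.sum_congr rfl fun i _ => ?_
      simp only [map_smul, PiLp.smul_apply, real_inner_smul_right]
      ring)
  refine ⟨L.mkContinuous₂ (Dmax + M) hbound, fun v w => rfl,
    LinearMap.mkContinuous₂_norm_le _ hDM' _, fun v => ?_⟩
  have h0 : (L.mkContinuous₂ (Dmax + M) hbound) v v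
      = ∑ i, (D i * inner ℝ (dx v i) (dx v i) + inner ℝ (m i (toL2 v i)) (dx v i)) := rfl
  have h1 : Dmin * ‖dx v‖ ^ 2 ≤ ∑ i, D i * inner ℝ (dx v i) (dx v i) := by
    rw [PiLp.norm_sq_eq_of_L2, Finset.mul_sum]
    refine Finset.sum_le_sum fun i _ => ?_
    rw [real_inner_self_eq_norm_sq]
    exact mul_le_mul_of_nonneg_right (hDmin i) (sq_nonneg _)
  have h2 := (abs_le.1 ((Finset.abs_sum_le_sum_abs _ _).trans (hmul v v))).1
  rw [h0, Finset.sum_add_distrib, norm_sq_V]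
  -- Young's inequality absorbs the drift into the diffusion
  have h3 : M * (‖toL2 v‖ * ‖dx v‖) ≤ M ^ 2 / (2 * Dmin) * ‖toL2 v‖ ^ 2 + Dmin / 2 * ‖dx v‖ ^ 2 := by
    have e : M ^ 2 / (2 * Dmin) * ‖toL2 v‖ ^ 2 + Dmin / 2 * ‖dx v‖ ^ 2 - M * (‖toL2 v‖ * ‖dx v‖)
        = (M * ‖toL2 v‖ - Dmin * ‖dx v‖) ^ 2 / (2 * Dmin) := by
      field_simp
      ring
    have e' : 0 ≤ (M * ‖toL2 v‖ - Dmin * ‖dx v‖) ^ 2 / (2 * Dmin) := by positivity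
    linarith
  linarith

/-- The forms `𝓕[u](·,·)` at time `t` agree for almost every `t` with a measurable family of bounded
forms satisfying Gårding's inequality. The family is built from a representative of `u` bounded
everywhere by `‖u‖`, so that these properties hold for every `t`. -/
theorem exists_timeForm_eq_form {D : Fin N → ℝ} {Dmin Dmax : ℝ}
    (hDmin : ∀ i, Dmin ≤ D i) (hDmax : ∀ i, D i ≤ Dmax) (hD : 0 < Dmin) (hDM : 0 ≤ Dmax)
    (u : LInfty l T) :
    ∃ B : ℝ → V l →L[ℝ] V l →L[ℝ] ℝ, (∀ v w, StronglyMeasurable fun t => B t v w) ∧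
      (∀ t, ‖B t‖ ≤ Dmax + ‖u‖) ∧
      (∀ t v, Dmin / 2 * ‖v‖ ^ 2
        ≤ B t v v + (‖u‖ ^ 2 / (2 * Dmin) + Dmin / 2) * ‖toL2 v‖ ^ 2) ∧
      ∀ᵐ t ∂leb 0 T, ∀ φ ψ, form D u t φ ψ = B t φ ψ := by
  choose k hkm hkb hku using fun i => exists_bounded_representative (u i)
  have hkb' : ∀ i z, |k i z| ≤ ‖u‖ := fun i z => (hkb i z).trans (PiLp.norm_apply_le u i)
  have hkt : ∀ t i, StronglyMeasurable fun x => k i (x, t) := fun t i =>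
    (hkm i).comp_measurable measurable_prodMk_right
  choose m hmb hme using fun t i =>
    exists_mul_clm (l i) (hkt t i) (M := ‖u‖) fun x => hkb' i (x, t)
  choose B hB hBK hBα using fun t =>
    exists_form_clm hDmin hDmax hD hDM (norm_nonneg u) (m t) (hmb t)
  have hinner : ∀ t i (v w : Lp ℝ 2 (leb 0 (l i))),
      inner ℝ (m t i v) w = ∫ x in Ioo 0 (l i), k i (x, t) * v x * w x := by
    intro t i v w
    rw [L2.inner_def]
    refine integral_congr_ae ((hme t i v).mono fun x hx => ?_)
    dsimp only
    rw [hx]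
    exact mul_comm _ _
  refine ⟨B, fun v w => ?_, hBK, hBα, ?_⟩
  · simp only [hB, hinner]
    refine Finset.stronglyMeasurable_fun_sum _ fun i _ => stronglyMeasurable_const.add ?_
    have : StronglyMeasurable fun z : ℝ × ℝ => k i z * toL2 v i z.1 * dx w i z.1 :=
      ((hkm i).mul ((Lp.stronglyMeasurable _).comp_measurable measurable_fst)).mul
        ((Lp.stronglyMeasurable _).comp_measurable measurable_fst)
    exact this.integral_prod_left'
  · have hae : ∀ i, ∀ᵐ t ∂leb 0 T, ∀ᵐ x ∂leb 0 (l i), u i (x, t) = k i (x, t) := by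
      intro i
      have hμ : (volume : Measure (ℝ × ℝ)).restrict (Ioo 0 (l i) ×ˢ Ioo 0 T)
          = (leb 0 (l i)).prod (leb 0 T) := by
        rw [Measure.volume_eq_prod, Measure.prod_restrict]
      have h1 : ∀ᵐ z ∂(leb 0 (l i)).prod (leb 0 T), u i z = k i z := by
        rw [← hμ]
        exact hku i
      rw [← Measure.ae_ae_comm]
      · exact Measure.ae_ae_of_ae_prod h1
      · exact measurableSet_eq_fun (Lp.stronglyMeasurable (u i)).measurable (hkm i).measurable
    filter_upwards [ae_all_iff.2 hae] with t ht φ ψ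
    rw [hB, form]
    refine Finset.sum_congr rfl fun i _ => ?_
    rw [L2.inner_def, hinner, ← integral_const_mul]
    have i1 : Integrable (fun x => D i * (dx φ i x * dx ψ i x)) (leb 0 (l i)) :=
      ((Lp.memLp (dx φ i)).integrable_mul (Lp.memLp (dx ψ i))).const_mul _
    have i2 : Integrable (fun x => k i (x, t) * toL2 φ i x * dx ψ i x) (leb 0 (l i)) := by
      have := ((Lp.memLp (m t i (toL2 φ i))).integrable_mul (Lp.memLp (dx ψ i)))
      refine this.congr ((hme t i (toL2 φ i)).mono fun x hx => ?_)
      simp only [Pi.mul_apply, hx]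
    have e1 : (fun x => D i * inner ℝ (dx φ i x) (dx ψ i x))
        = fun x => D i * (dx φ i x * dx ψ i x) :=
      funext fun x => congrArg (D i * ·) (mul_comm _ _)
    rw [e1, ← integral_add i1 i2]
    refine integral_congr_ae ((ht i).mono fun x hx => ?_)
    dsimp only
    rw [hx]
    ring

/-- If the forms `𝓕[u]` agree for almost every time with the family `B`, then weak solutions are the
solutions of the abstract evolution equation for `B`. -/
theorem isWeakSolution_iff {hT : 0 < T} {D : Fin N → ℝ} {u : LInfty l T}
    {B : ℝ → V l →L[ℝ] V l →L[ℝ] ℝ} {K : ℝ} (hBm : ∀ v w, StronglyMeasurable fun t => B t v w)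
    (hBK : ∀ t, ‖B t‖ ≤ K) (hBu : ∀ᵐ t ∂leb 0 T, ∀ φ ψ, form D u t φ ψ = B t φ ψ)
    (f : L2Time T (VDual l)) (ρ₀ : L2 l) (ρ : W l T) :
    IsWeakSolution hT D u f ρ₀ ρ ↔ IsEvolutionSolution hT B f ρ₀ ρ := by
  have := secondCountableTopology_V l
  have key := distributional_iff_ae hBm hBK f ρ
  have e : ∀ (φ : V l) (θ : 𝓓(interval 0 T, ℝ)),
      ∫ t in Ioo 0 T, form D u t (toL2V ρ t) φ * θ t = ∫ t in Ioo 0 T, B t (ρ.1.fst t) φ * θ t :=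
    fun φ θ => integral_congr_ae (hBu.mono fun t ht => congrArg (· * θ t) (ht _ _))
  constructor
  · rintro ⟨h1, h2⟩
    refine ⟨key.1 fun φ θ => ?_, h2⟩
    rw [← e]
    exact h1 φ θ
  · rintro ⟨h1, h2⟩
    refine ⟨fun φ θ => ?_, h2⟩
    rw [e]
    exact key.2 h1 φ θ

end Form

/-! ### The constant in the estimates -/

section Constant

/-- The constant `C(T, D̲, D̄, M)` of the a priori estimates, `M` being the norm of the drift.
The absolute values make it positive for all real arguments; the theorem uses it for positive `D̲`
only, so that no division by zero occurs. -/
def aprioriConst (T Dmin Dmax M : ℝ) : ℝ :=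
  (2 + |Dmax| + |M|) * (1 + 1 / √(Dmin / 2)) ^ 2
    * Real.exp ((M ^ 2 / (2 * Dmin) + Dmin / 2) * T)

theorem aprioriConst_pos (T Dmin Dmax M : ℝ) : 0 < aprioriConst T Dmin Dmax M := by
  unfold aprioriConst
  positivity

theorem continuous_aprioriConst (T Dmin Dmax : ℝ) : Continuous (aprioriConst T Dmin Dmax) := by
  unfold aprioriConst
  fun_prop

/-- Collects the separate bounds for the representative (`c`), the state (`a`) and its time
derivative (`b`) into a single constant. Here `s` stands for `√(D̲/2)`. -/
theorem add_le_and_add_le_of_bounds {E s K R F a b c : ℝ} (hE : 1 ≤ E) (hs : 0 < s) (hK : 0 ≤ K)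
    (hR : 0 ≤ R) (hF : 0 ≤ F) (hc : c ≤ E * (R + F / s)) (ha : a ≤ E * (R + F / s) / s)
    (hb : b ≤ F + K * a) :
    c + a ≤ (2 + K) * (1 + 1 / s) ^ 2 * E * (R + F) ∧
      a + b ≤ (2 + K) * (1 + 1 / s) ^ 2 * E * (R + F) := by
  set q := 1 / s with hq
  have hq0 : 0 < q := by positivity
  have hP : 0 ≤ E * (R + F) := by positivity
  have h1 : E * (R + F / s) ≤ (1 + q) * (E * (R + F)) := by
    have : R + F / s ≤ (1 + q) * (R + F) := by
      rw [div_eq_mul_one_div, ← hq]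
      nlinarith [mul_nonneg hq0.le hR]
    calc E * (R + F / s) ≤ E * ((1 + q) * (R + F)) := by gcongr
      _ = _ := by ring
  have h2 : a ≤ q * ((1 + q) * (E * (R + F))) := by
    refine ha.trans ?_
    rw [div_eq_mul_one_div, ← hq, mul_comm]
    gcongr
  have h3 : F ≤ E * (R + F) := by nlinarith
  have h4 : b ≤ F + K * (q * ((1 + q) * (E * (R + F)))) := hb.trans (by gcongr)
  have hqP := mul_nonneg hq0.le hP
  have hqqP := mul_nonneg hq0.le hqP
  have hKP := mul_nonneg hK hP
  have hKqP := mul_nonneg hK hqP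
  have hKqqP := mul_nonneg hK hqqP
  constructor <;> nlinarith

/-- The two estimates for weak solutions, from the abstract ones with `α = D̲/2`,
`λ = ‖u‖²/(2D̲) + D̲/2` and `K = D̄ + ‖u‖`. -/
theorem IsEvolutionSolution.estimates {N : ℕ} {l : Fin N → ℝ} {T : ℝ} {hT : 0 < T}
    [SecondCountableTopology (V l)] [CompleteSpace (V l)]
    {B : ℝ → V l →L[ℝ] V l →L[ℝ] ℝ} {Dmin Dmax M : ℝ} (hD : 0 < Dmin) (hDM : 0 ≤ Dmax)
    (hM : 0 ≤ M) (hBK : ∀ t, ‖B t‖ ≤ Dmax + M)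
    (hB : ∀ t v, Dmin / 2 * ‖v‖ ^ 2
      ≤ B t v v + (M ^ 2 / (2 * Dmin) + Dmin / 2) * ‖toL2 v‖ ^ 2)
    {f : L2Time T (VDual l)} {ρ₀ : L2 l} {ρ : W l T} (h : IsEvolutionSolution hT B f ρ₀ ρ) :
    (∃ r : C(Icc 0 T, L2 l), IsTimeRep ρ r ∧
      ‖r‖ + ‖toL2V ρ‖ ≤ aprioriConst T Dmin Dmax M * (‖ρ₀‖ + ‖f‖)) ∧
    ‖ρ‖ ≤ aprioriConst T Dmin Dmax M * (‖ρ₀‖ + ‖f‖) := by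
  obtain ⟨r, hr, hr₀⟩ := h.initial
  have hlam : 0 ≤ M ^ 2 / (2 * Dmin) + Dmin / 2 := by positivity
  obtain ⟨hc, ha⟩ := IsEvolutionSolution.norm_rep_le hlam (half_pos hD) hB h hr hr₀
  have hb := IsEvolutionSolution.norm_snd_le hBK h
  have hE : 1 ≤ Real.exp ((M ^ 2 / (2 * Dmin) + Dmin / 2) * T) :=
    Real.one_le_exp (by positivity)
  -- `k1` bounds `‖r‖ + ‖ρ‖_{L²(V)}`, and `k2` bounds `‖ρ‖_{L²(V)} + ‖ρ'‖_{L²(V*)}`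
  obtain ⟨k1, k2⟩ := add_le_and_add_le_of_bounds hE (Real.sqrt_pos.2 (half_pos hD))
    (add_nonneg hDM hM) (norm_nonneg ρ₀) (norm_nonneg f) hc ha hb
  have hC : aprioriConst T Dmin Dmax M = (2 + (Dmax + M)) * (1 + 1 / √(Dmin / 2)) ^ 2
      * Real.exp ((M ^ 2 / (2 * Dmin) + Dmin / 2) * T) := by
    rw [aprioriConst, abs_of_nonneg hDM, abs_of_nonneg hM, add_assoc]
  rw [hC]
  refine ⟨⟨r, hr, k1⟩, le_trans ?_ k2⟩
  have : ‖ρ‖ ^ 2 = ‖ρ.1.fst‖ ^ 2 + ‖ρ.1.snd‖ ^ 2 := WithLp.prod_norm_sq_eq_of_L2 ρ.1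
  nlinarith [norm_nonneg ρ, norm_nonneg ρ.1.fst, norm_nonneg ρ.1.snd,
    mul_nonneg (norm_nonneg ρ.1.fst) (norm_nonneg ρ.1.snd)]

end Constant

end StarGraph

end

open StarGraph in
theorem theorem3p1 :
    ∃ C : ℝ → ℝ → ℝ → ℝ → ℝ,
      (∀ T Dmin Dmax M : ℝ, 0 < C T Dmin Dmax M) ∧
      (∀ T Dmin Dmax : ℝ, Continuous (C T Dmin Dmax)) ∧
      ∀ (N : ℕ) (_ : 1 ≤ N) (l : Fin N → ℝ) (_ : ∀ i, 0 < l i) (T : ℝ) (hT : 0 < T)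
        (D : Fin N → ℝ) (_ : ∀ i, 0 < D i)
        (f : L2Time T (VDual l)) (u : LInfty l T) (ρ₀ : L2 l),
        (∃! ρ : W l T, IsWeakSolution hT D u f ρ₀ ρ) ∧
        ∀ ρ : W l T, IsWeakSolution hT D u f ρ₀ ρ →
          (∃ r : C(Set.Icc 0 T, L2 l), IsTimeRep ρ r ∧
            ‖r‖ + ‖toL2V ρ‖ ≤ C T (⨅ i, D i) (⨆ i, D i) ‖u‖ * (‖ρ₀‖ + ‖f‖)) ∧
          ‖ρ‖ ≤ C T (⨅ i, D i) (⨆ i, D i) ‖u‖ * (‖ρ₀‖ + ‖f‖) := by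
  refine ⟨aprioriConst, aprioriConst_pos, continuous_aprioriConst, ?_⟩
  intro N hN l hl T hT D hDpos f u ρ₀
  -- `⨅` and `⨆` are the minimum and the maximum because there is at least one edge
  have : Nonempty (Fin N) := ⟨⟨0, hN⟩⟩
  have hDmin : ∀ i, ⨅ i, D i ≤ D i := fun i => ciInf_le (Set.finite_range D).bddBelow i
  have hDmax : ∀ i, D i ≤ ⨆ i, D i := fun i => le_ciSup (Set.finite_range D).bddAbove i
  have hD : 0 < ⨅ i, D i := by
    obtain ⟨i, hi⟩ := exists_eq_ciInf_of_finite (f := D)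
    rw [← hi]
    exact hDpos i
  have hDM : 0 ≤ ⨆ i, D i := (hDpos ⟨0, hN⟩).le.trans (hDmax _)
  have := secondCountableTopology_V l
  have := completeSpace_V hl
  obtain ⟨B, hBm, hBK, hB, hBu⟩ := exists_timeForm_eq_form hDmin hDmax hD hDM u
  have hiff := isWeakSolution_iff (hT := hT) hBm hBK hBu f ρ₀
  have hlam : 0 ≤ ‖u‖ ^ 2 / (2 * ⨅ i, D i) + (⨅ i, D i) / 2 := by positivity
  refine ⟨?_, fun ρ hρ =>
    ((hiff ρ).1 hρ).estimates hD hDM (norm_nonneg u) hBK hB⟩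
  obtain ⟨ρ, hρ⟩ := exists_isEvolutionSolution hT (denseRange_toL2 hl) hBm hBK hlam
    (half_pos hD) hB f ρ₀
  exact ⟨ρ, (hiff ρ).2 hρ, fun ρ' hρ' =>
    IsEvolutionSolution.unique hBK hlam (half_pos hD) hB ((hiff ρ').1 hρ') hρ⟩
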